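/- Index the Fibonacci numbers by $F_1=1$, $F_2=2$, $F_k=F_{k-1}+F_{k-2}$ for $k\ge 3$. The Zeckendorf game on input $N$ is played on a multiset of Fibonacci numbers that initially consists of $N$ copies of $F_1$. The moves are: $C_1$, which replaces two copies of $F_1$ by one $F_2$; $C_k$ for $k\ge 2$, which replaces one $F_{k-1}$ and one $F_k$ by one $F_{k+1}$; $S_2$, which replaces two copies of $F_2$ by one $F_1$ and one $F_3$; and $S_k$ for $k\ge 3$, which replaces two copies of $F_k$ by one $F_{k-2}$ and one $F_{k+1}$. A move is playable if the multiset contains the elements that it replaces. A game on input $N$ is a finite sequence of moves $\mathcal G=(M_1,\dots,M_\lambda)$, each playable when it is made, after which no move is playable; its length is $\lambda$. Let $\Omega_N$ be the (finite, non-empty) set of all games on input $N$. Let $\mu_N$ be the uniform probability measure on $\Omega_N$, and let $\mathbb P_N$ be the probability measure on $\Omega_N$ that arises by choosing at each step uniformly at random among the playable moves, that is, $$\mathbb P_N(\mathcal G)=\prod_{k=1}^{\lambda}\frac{1}{\#\{\text{playable moves after }(M_1,\dots,M_{k-1})\}}\qquad\text{for }\mathcal G=(M_1,\dots,M_\lambda)\in\Omega_N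 .$$ **Theorem.** For every integer $Z\ge 1$ and every $z\in\{0,1,\dots,Z-1\}$, $$\lim_{N\to\infty}\mu_N\bigl(\text{game length}\equiv z \bmod Z\bigr)=\lim_{N\to\infty}\mathbb P_N\bigl(\text{game length}\equiv z \bmod Z\bigr)=\frac1Z .$$ -/

import Mathlib

open Filter Topology
open scoped ENNReal

namespace Zeckendorf

/-- The Fibonacci numbers indexed so that `F 1 = 1`, `F 2 = 2`, `F (n + 2) = F (n + 1) + F n`. -/
def F (k : ℕ) : ℕ := Nat.fib (k + 1)

/-- Names of moves: the combine moves `C k` (meaningful for `1 ≤ k`) and the splitting moves `S k`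
(meaningful for `2 ≤ k`). -/
inductive Move : Type
  | C (k : ℕ) : Move
  | S (k : ℕ) : Move

namespace Move

/-- The range of the index of a move: `C_1, C_2, …` and `S_2, S_3, …`. -/
def Valid : Move → Prop
  | C k => 1 ≤ k
  | S k => 2 ≤ k

/-- The two tokens that a move removes. -/
def removed : Move → Multiset ℕ
  | C k => if k = 1 then {F 1, F 1} else {F (k - 1), F k}
  | S k => {F k, F k}

/-- The tokens that a move adds. -/
def added : Move → Multiset ℕ
  | C k => {F (k + 1)}
  | S k => if k = 2 then {F 1, F 3} else {F (k - 2), F (k + 1)}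

end Move

/-- The move `m` is playable at the multiset `s` of Fibonacci numbers. -/
def Playable (s : Multiset ℕ) (m : Move) : Prop := m.Valid ∧ m.removed ≤ s

/-- The multiset after playing `m` at `s`. -/
def play (s : Multiset ℕ) (m : Move) : Multiset ℕ := s - m.removed + m.added

/-- The number of moves that are playable at `s`. -/
noncomputable def numPlayable (s : Multiset ℕ) : ℕ := {m : Move | Playable s m}.ncard

/-- `l` is a complete sequence of moves from `s`: each move is playable when it is played, and
no move is playable at the end. -/
def IsGameFrom : Multiset ℕ → List Move → Prop
  | s, [] => ∀ m, ¬ Playable s m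
  | s, m :: l => Playable s m ∧ IsGameFrom (play s m) l

/-- The probability of the sequence of moves `l` from `s` when each move is chosen uniformly among
the playable ones: the product of the reciprocals of the numbers of playable moves at the
positions at which the moves of `l` are played. -/
noncomputable def stepWeight : Multiset ℕ → List Move → ℝ≥0∞
  | _, [] => 1
  | s, m :: l => (numPlayable s : ℝ≥0∞)⁻¹ * stepWeight (play s m) l

/-- The set of all Zeckendorf games on input `N`, which start at `N` copies of `F 1`. -/
def Game (N : ℕ) : Type := {l : List Move // IsGameFrom (Multiset.replicate N (F 1)) l}

/-- The number of moves of a game. -/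
def Game.length {N : ℕ} (G : Game N) : ℕ := List.length G.1

/-- All sets of games are events. -/
instance (N : ℕ) : MeasurableSpace (Game N) := ⊤

/-! Helper facts: a position has finitely many playable moves, the game terminates, there are
finitely many games, and the step weights add up to one. -/

/-- Weight of a token in the potential: `3` for `F 1` and `k + 3` for `F k`, `2 ≤ k`. -/
def tokenWeight (v : ℕ) : ℕ := if v = 1 then 3 else Nat.greatestFib v + 2

theorem tokenWeight_one : tokenWeight (F 1) = 3 := by simp [tokenWeight, F]

theorem tokenWeight_F {k : ℕ} (hk : 2 ≤ k) : tokenWeight (F k) = k + 3 := by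
  have h : F k ≠ 1 := by
    have h1 : Nat.fib 3 ≤ Nat.fib (k + 1) := Nat.fib_mono (by omega)
    have h2 : Nat.fib 3 = 2 := rfl
    unfold F
    omega
  rw [tokenWeight, if_neg h, F, Nat.greatestFib_fib (by omega)]

/-- A potential that every move decreases. -/
def potential (s : Multiset ℕ) : ℕ := (s.map tokenWeight).sum

theorem potential_play_lt {s : Multiset ℕ} {m : Move} (h : Playable s m) :
    potential (play s m) < potential s := by
  obtain ⟨hv, hle⟩ := h
  obtain ⟨t, rfl⟩ := Multiset.le_iff_exists_add.1 hle
  have key : (m.added.map tokenWeight).sum < (m.removed.map tokenWeight).sum := by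
    cases m with
    | C k =>
      have hk : 1 ≤ k := hv
      have e := tokenWeight_F (k := k + 1) (by omega)
      rcases Nat.lt_or_ge k 2 with h1 | h1
      · obtain rfl : k = 1 := by omega
        simp [Move.added, Move.removed, tokenWeight_one, e]
      · have e1 := tokenWeight_F h1
        rcases Nat.lt_or_ge k 3 with h2 | h2
        · obtain rfl : k = 2 := by omega
          simp [Move.added, Move.removed, tokenWeight_one, e, e1]
        · have e2 := tokenWeight_F (k := k - 1) (by omega)
          simp [Move.added, Move.removed, show k ≠ 1 by omega, e, e1, e2]
          omega
    | S k =>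
      have hk : 2 ≤ k := hv
      have e := tokenWeight_F (k := k + 1) (by omega)
      have e1 := tokenWeight_F hk
      rcases Nat.lt_or_ge k 3 with h1 | h1
      · obtain rfl : k = 2 := by omega
        simp [Move.added, Move.removed, tokenWeight_one, e, e1]
      · rcases Nat.lt_or_ge k 4 with h2 | h2
        · obtain rfl : k = 3 := by omega
          simp [Move.added, Move.removed, tokenWeight_one, e, e1]
        · have e2 := tokenWeight_F (k := k - 2) (by omega)
          simp [Move.added, Move.removed, show k ≠ 2 by omega, e, e1, e2]
          omega
  simp only [play, potential, add_tsub_cancel_left, Multiset.map_add, Multiset.sum_add]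
  omega

theorem finite_playable (s : Multiset ℕ) : {m : Move | Playable s m}.Finite := by
  have hfin : {k : ℕ | 1 ≤ k ∧ F k ∈ s}.Finite := by
    refine Set.Finite.subset (s.toFinset.finite_toSet.image fun v => Nat.greatestFib v - 1) ?_
    rintro k ⟨hk, hmem⟩
    refine ⟨F k, by simpa using hmem, ?_⟩
    simp [F, Nat.greatestFib_fib (n := k + 1) (by omega)]
  refine ((hfin.image Move.C).union (hfin.image Move.S)).subset ?_
  rintro (k | k) ⟨hv, hle⟩
  · refine Or.inl ⟨k, ⟨hv, Multiset.mem_of_le hle ?_⟩, rfl⟩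
    by_cases h : k = 1 <;> simp [Move.removed, h]
  · have hv' : 2 ≤ k := hv
    exact Or.inr ⟨k, ⟨by omega, Multiset.mem_of_le hle (by simp [Move.removed])⟩, rfl⟩

theorem finite_isGameFrom (s : Multiset ℕ) : {l : List Move | IsGameFrom s l}.Finite := by
  induction hn : potential s using Nat.strong_induction_on generalizing s with
  | _ n ih =>
    subst hn
    refine Set.Finite.subset ((Set.finite_singleton ([] : List Move)).union
      ((finite_playable s).biUnion (t := fun m => List.cons m '' {l | IsGameFrom (play s m) l})
        fun m hm => (ih _ (potential_play_lt hm) _ rfl).image _)) ?_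
    rintro (_ | ⟨m, l⟩) h
    · exact Or.inl rfl
    · exact Or.inr (Set.mem_biUnion (show m ∈ {m | Playable s m} from h.1) ⟨l, h.2, rfl⟩)

theorem exists_isGameFrom (s : Multiset ℕ) : ∃ l, IsGameFrom s l := by
  induction hn : potential s using Nat.strong_induction_on generalizing s with
  | _ n ih =>
    subst hn
    by_cases h : ∃ m, Playable s m
    · obtain ⟨m, hm⟩ := h
      obtain ⟨l, hl⟩ := ih _ (potential_play_lt hm) _ rfl
      exact ⟨m :: l, hm, hl⟩
    · exact ⟨[], not_exists.1 h⟩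

theorem tsum_list (f : List Move → ℝ≥0∞) :
    ∑' l, f l = f [] + ∑' m, ∑' l, f (m :: l) := by
  let e : Unit ⊕ (Move × List Move) ≃ List Move :=
    { toFun := Sum.elim (fun _ => []) fun p => p.1 :: p.2
      invFun := fun l => match l with
        | [] => Sum.inl ()
        | m :: l => Sum.inr (m, l)
      left_inv := by rintro (_ | ⟨m, l⟩) <;> rfl
      right_inv := by rintro (_ | ⟨m, l⟩) <;> rfl }
  rw [← e.tsum_eq f, Summable.tsum_sum ENNReal.summable ENNReal.summable, ENNReal.tsum_prod',
    tsum_fintype]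
  simp [e]

open Classical in
theorem tsum_stepWeight (s : Multiset ℕ) :
    ∑' l, (if IsGameFrom s l then stepWeight s l else 0) = 1 := by
  induction hn : potential s using Nat.strong_induction_on generalizing s with
  | _ n ih =>
    subst hn
    rw [tsum_list]
    have h2 : ∀ m, ∑' l, (if IsGameFrom s (m :: l) then stepWeight s (m :: l) else 0)
        = if Playable s m then (numPlayable s : ℝ≥0∞)⁻¹ else 0 := by
      intro m
      by_cases hm : Playable s m
      · have h3 := ih _ (potential_play_lt hm) _ rfl
        simp only [IsGameFrom, hm, true_and, if_true, stepWeight]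
        simp_rw [← mul_ite_zero]
        rw [ENNReal.tsum_mul_left, h3, mul_one]
      · simp [IsGameFrom, hm]
    simp only [h2]
    have hs : (∑' m, if Playable s m then (numPlayable s : ℝ≥0∞)⁻¹ else 0)
        = (numPlayable s : ℝ≥0∞) * (numPlayable s : ℝ≥0∞)⁻¹ := by
      rw [tsum_eq_sum (s := (finite_playable s).toFinset) (by
        intro m hm
        have hm' : ¬ Playable s m := by simpa using hm
        simp [hm'])]
      rw [Finset.sum_congr rfl (g := fun _ => (numPlayable s : ℝ≥0∞)⁻¹) (by
        intro m hm
        have hm' : Playable s m := by simpa using hm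
        simp [hm'])]
      rw [Finset.sum_const, nsmul_eq_mul, numPlayable,
        Set.ncard_eq_toFinset_card _ (finite_playable s)]
    rw [hs]
    by_cases h : ∃ m, Playable s m
    · have h0 : numPlayable s ≠ 0 := by
        exact ((Set.ncard_pos (finite_playable s)).2 h).ne'
      rw [ENNReal.mul_inv_cancel (by exact_mod_cast h0) (ENNReal.natCast_ne_top _)]
      have h4 : ¬ IsGameFrom s [] := fun h5 => h.elim h5
      simp [h4]
    · have h0 : numPlayable s = 0 := by
        have h6 : {m : Move | Playable s m} = ∅ := by
          ext m
          simpa using not_exists.1 h m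
        simp [numPlayable, h6]
      have h4 : IsGameFrom s [] := not_exists.1 h
      simp [h4, h0, stepWeight]

instance (N : ℕ) : Finite (Game N) := (finite_isGameFrom _).to_subtype

instance (N : ℕ) : Nonempty (Game N) := nonempty_subtype.2 (exists_isGameFrom _)

noncomputable instance (N : ℕ) : Fintype (Game N) := Fintype.ofFinite _

theorem tsum_game_stepWeight (N : ℕ) :
    ∑' G : Game N, stepWeight (Multiset.replicate N (F 1)) G.1 = 1 := by
  classical
  rw [← tsum_stepWeight (Multiset.replicate N (F 1))]
  refine (tsum_subtype {l | IsGameFrom (Multiset.replicate N (F 1)) l}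
    (stepWeight (Multiset.replicate N (F 1)))).trans ?_
  refine tsum_congr fun l => ?_
  simp [Set.indicator]

/-- The uniform probability measure on all games on input `N`. -/
noncomputable def uniformMeasure (N : ℕ) : MeasureTheory.Measure (Game N) :=
  (PMF.uniformOfFintype (Game N)).toMeasure

/-- The law of the game on input `N` in which every move is chosen uniformly among the moves that
are playable at that time. -/
noncomputable def randomMoveMeasure (N : ℕ) : MeasureTheory.Measure (Game N) :=
  PMF.toMeasure ⟨fun G => stepWeight (Multiset.replicate N (F 1)) G.1,
    (tsum_game_stepWeight N) ▸ ENNReal.summable.hasSum⟩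

end Zeckendorf

namespace Zeckendorf

/-! By Fourier inversion on the residues mod `Z`, it suffices that for each `ω ≠ 1` of modulus one
the mean of `ω ^ length` tends to 0 under both measures. The source of cancellation is that `C 2` in
one move, and `C 1`, `S 2` in either order in two moves, have the same net effect: one `F 1` and one
`F 2` become one `F 3`. Pairing the two routes puts `1 + ω` in place of 2, and `‖1 + ω‖ < 2`.

Random moves: while many `F 1` remain, every position is one `C 1` away from a position where both
routes are open. Positions with sum `N` have at most `K = O(log N)` playable moves, so the mean
shrinks by a factor `1 - δ / K ^ 3` for every six tokens `F 1` (`norm_randomCharSum_le`,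
`numPlayable_le`). As `N / K ^ 3` tends to infinity, the product over `N / 6` blocks tends to 0.

Uniform games: all games weigh the same, so each `C 2` played where a detour is available yields a
factor `κ = ‖1 + ω‖ / 2 < 1`, and the character sum is at most the sum of `κ ^ trades`
(`norm_charSum_le_tradeSum`). It remains to see that few games have at most `J` trades. Such a game
must still use up its `F 1` and `F 2`, hence plays `C 1` and `S 2` linearly often, and order `N ^ 2`
distant pairs of these can be merged into one `C 2` (`exists_many_trades`). A merged game determines
its origin up to `O(J N)` choices (`trade_injective`), so the proportion of games with few trades is
`O(J / N)` (`card_few_trades_mul_le`). -/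

noncomputable instance : DecidableEq Move := Classical.decEq _

/-! ### Sums over games, split by the first move -/

/-- The moves that are playable at `s`. -/
noncomputable def moves (s : Multiset ℕ) : Finset Move := (finite_playable s).toFinset

/-- The complete sequences of moves from `s`. -/
noncomputable def games (s : Multiset ℕ) : Finset (List Move) := (finite_isGameFrom s).toFinset

@[simp] theorem mem_moves {s : Multiset ℕ} {m : Move} : m ∈ moves s ↔ Playable s m := by
  simp [moves]

@[simp] theorem mem_games {s : Multiset ℕ} {l : List Move} : l ∈ games s ↔ IsGameFrom s l := by
  simp [games]

theorem card_moves (s : Multiset ℕ) : (moves s).card = numPlayable s :=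
  (Set.ncard_eq_toFinset_card _ _).symm

theorem sum_games_of_terminal {M : Type*} [AddCommMonoid M] {s : Multiset ℕ} (h : moves s = ∅)
    (φ : List Move → M) : ∑ l ∈ games s, φ l = φ [] := by
  have h0 : ∀ m, ¬ Playable s m := fun m hm => by simpa [h] using mem_moves.2 hm
  have : games s = {[]} := by
    ext (_ | ⟨m, l⟩)
    · simpa [IsGameFrom] using h0
    · simp [IsGameFrom, h0]
  simp [this]

theorem sum_games {M : Type*} [AddCommMonoid M] {s : Multiset ℕ} (h : (moves s).Nonempty)
    (φ : List Move → M) :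
    ∑ l ∈ games s, φ l = ∑ m ∈ moves s, ∑ l ∈ games (play s m), φ (m :: l) := by
  have : games s = (moves s).biUnion fun m => (games (play s m)).image (List.cons m) := by
    ext (_ | ⟨m, l⟩)
    · obtain ⟨m, hm⟩ := h
      simp only [mem_games, IsGameFrom, Finset.mem_biUnion, Finset.mem_image]
      constructor
      · intro h; exact absurd (mem_moves.1 hm) (h m)
      · rintro ⟨_, _, _, _, h⟩; simp at h
    · simp only [mem_games, IsGameFrom, Finset.mem_biUnion, Finset.mem_image, mem_moves]
      constructor
      · rintro ⟨h1, h2⟩; exact ⟨m, h1, l, h2, rfl⟩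
      · rintro ⟨m', h1, l', h2, h3⟩
        simp only [List.cons.injEq] at h3
        obtain ⟨rfl, rfl⟩ := h3
        exact ⟨h1, h2⟩
  rw [this, Finset.sum_biUnion]
  · refine Finset.sum_congr rfl fun m _ => ?_
    rw [Finset.sum_image]
    intro a _ b _ hab
    simpa using hab
  · intro m _ m' _ hne
    rw [Function.onFun, Finset.disjoint_left]
    intro l hl hl'
    simp only [Finset.mem_image] at hl hl'
    obtain ⟨a, _, rfl⟩ := hl
    obtain ⟨b, _, hb⟩ := hl'
    simp only [List.cons.injEq] at hb
    exact hne hb.1.symm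

/-! ### Effect of a move on token counts and weights -/

theorem play_add_removed {s : Multiset ℕ} {m : Move} (h : Playable s m) :
    play s m + m.removed = s + m.added := by
  rw [play, add_right_comm, tsub_add_cancel_of_le h.2]

theorem count_play {s : Multiset ℕ} {m : Move} (h : Playable s m) (v : ℕ) :
    (play s m).count v + m.removed.count v = s.count v + m.added.count v := by
  rw [← Multiset.count_add, play_add_removed h, Multiset.count_add]

@[simp] theorem F_one : F 1 = 1 := rfl
@[simp] theorem F_two : F 2 = 2 := rfl
@[simp] theorem F_three : F 3 = 3 := rfl
@[simp] theorem F_four : F 4 = 5 := rfl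
@[simp] theorem F_five : F 5 = 8 := rfl

theorem F_mono : Monotone F := fun _ _ h => Nat.fib_mono (Nat.add_le_add_right h 1)

theorem three_le_F {k : ℕ} (hk : 3 ≤ k) : 3 ≤ F k := F_mono hk

theorem F_add_two (k : ℕ) : F (k + 2) = F k + F (k + 1) := Nat.fib_add_two

theorem move_cases {m : Move} (h : m.Valid) :
    m = .C 1 ∨ m = .C 2 ∨ m = .C 3 ∨ (∃ k, m = .C (k + 4)) ∨
      m = .S 2 ∨ m = .S 3 ∨ m = .S 4 ∨ ∃ k, m = .S (k + 5) := by
  rcases m with k | k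
  · have hk : 1 ≤ k := h
    rcases k with _ | _ | _ | _ | k <;> simp at hk ⊢
  · have hk : 2 ≤ k := h
    rcases k with _ | _ | _ | _ | _ | k <;> simp at hk ⊢

theorem sum_removed {m : Move} (h : m.Valid) : m.removed.sum = m.added.sum := by
  rcases m with k | k
  · have hk : 1 ≤ k := h
    rcases k with _ | _ | k
    · simp at hk
    · rfl
    · simp [Move.removed, Move.added, F_add_two]
  · have hk : 2 ≤ k := h
    rcases k with _ | _ | _ | k
    · simp at hk
    · simp at hk
    · rfl
    · simp [Move.removed, Move.added, F_add_two]
      omega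

theorem sum_play {s : Multiset ℕ} {m : Move} (h : Playable s m) : (play s m).sum = s.sum := by
  have h1 := congrArg Multiset.sum (play_add_removed h)
  rw [Multiset.sum_add, Multiset.sum_add, sum_removed h.1] at h1
  omega

theorem count_removed_le (m : Move) (v : ℕ) : m.removed.count v ≤ 2 := by
  refine (Multiset.count_le_card _ _).trans ?_
  rcases m with k | k
  · by_cases hk : k = 1 <;> simp [Move.removed, hk]
  · simp [Move.removed]

theorem count_le_count_play {s : Multiset ℕ} {m : Move} (h : Playable s m) (v : ℕ) :
    s.count v ≤ (play s m).count v + 2 := by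
  have := count_play h v
  have := count_removed_le m v
  omega

/-- A weight on the tokens `F k`, `3 ≤ k`, for which the moves other than the ones that create a
new such token do not increase the total. -/
def upperWeight (v : ℕ) : ℕ :=
  if v ≤ 2 then 0 else if v = 3 then 5 else if v = 5 then 4 else if v = 8 then 6
  else Nat.greatestFib v - 1

theorem upperWeight_F {k : ℕ} (hk : 6 ≤ k) : upperWeight (F k) = k := by
  have h : 13 ≤ F k := F_mono hk
  unfold upperWeight
  rw [if_neg (by omega), if_neg (by omega), if_neg (by omega), if_neg (by omega), F,
    Nat.greatestFib_fib (by omega)]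
  rfl

/-- The total weight of the tokens `F k`, `3 ≤ k`. -/
def upper (s : Multiset ℕ) : ℕ := (s.map upperWeight).sum

theorem upper_play {s : Multiset ℕ} {m : Move} (h : Playable s m) :
    upper (play s m) + upper m.removed = upper s + upper m.added := by
  have := congrArg upper (play_add_removed h)
  simpa [upper] using this

theorem upperWeight_one : upperWeight 1 = 0 := rfl
theorem upperWeight_two : upperWeight 2 = 0 := rfl
theorem upperWeight_three : upperWeight 3 = 5 := rfl
theorem upperWeight_five : upperWeight 5 = 4 := rfl
theorem upperWeight_eight : upperWeight 8 = 6 := rfl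
theorem upperWeight_F_add_five (k : ℕ) : upperWeight (F (k + 5)) = k + 5 + (if k = 0 then 1 else 0)
    := by
  rcases k with _ | k
  · rfl
  · rw [upperWeight_F (by omega)]; simp

/-- `C 1` and `C 2` are the only moves that consume tokens `F 1`. -/
theorem count_one_step {s : Multiset ℕ} {m : Move} (h : Playable s m) :
    s.count 1 ≤ (play s m).count 1 + (if m = .C 1 then 2 else 0) + (if m = .C 2 then 1 else 0) := by
  have h1 := count_play h 1
  have h3' : ∀ k, 3 ≤ k → (1 = F k) = False := fun k hk => by
    have := three_le_F hk; simp; omega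
  rcases move_cases h.1 with rfl | rfl | rfl | ⟨k, rfl⟩ | rfl | rfl | rfl | ⟨k, rfl⟩ <;>
    simp [Move.removed, Move.added, h3'] at h1 ⊢ <;>
    omega

/-- Besides `C 2` and `S 2`, only `C 3` consumes an `F 2`; the drop of the weight from 5 at `F 3` to
4 at `F 4` pays for it. The moves `C 2` and `S 2` create an `F 3` of weight 5 and consume one or two
`F 2`, whence `6 = 5 + 1` and `7 = 5 + 2`. So many `C 1` with few `C 2` and `S 2` force many `F 2`
to be present. -/
theorem count_two_step {s : Multiset ℕ} {m : Move} (h : Playable s m) :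
    (if m = .C 1 then 1 else 0) + upper (play s m) + s.count 2 ≤
      (play s m).count 2 + upper s + 6 * (if m = .C 2 then 1 else 0)
        + 7 * (if m = .S 2 then 1 else 0) := by
  have h1 := count_play h 2
  have h2 := upper_play h
  have h3' : ∀ k, 3 ≤ k → (2 = F k) = False := fun k hk => by
    have := three_le_F hk; simp; omega
  rcases move_cases h.1 with rfl | rfl | rfl | ⟨k, rfl⟩ | rfl | rfl | rfl | ⟨k, rfl⟩
  · simp [Move.removed, Move.added, upper, upperWeight_one, upperWeight_two] at h1 h2 ⊢
    omega
  · simp [Move.removed, Move.added, upper, upperWeight_one, upperWeight_two,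
      upperWeight_three] at h1 h2 ⊢
    omega
  · simp [Move.removed, Move.added, upper, upperWeight_three, upperWeight_two,
      upperWeight_five] at h1 h2 ⊢
    omega
  · have h4 : upperWeight (F (k + 5)) ≤ upperWeight (F (k + 3)) + upperWeight (F (k + 4)) := by
      rcases k with _ | _ | _ | k
      · decide
      · decide
      · decide
      · rw [upperWeight_F (by omega), upperWeight_F (by omega), upperWeight_F (by omega)]; omega
    simp [Move.removed, Move.added, upper, h3'] at h1 h2 ⊢
    simp only [add_assoc, Nat.reduceAdd] at h1 h2
    omega
  · simp [Move.removed, Move.added, upper, upperWeight_one, upperWeight_two,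
      upperWeight_three] at h1 h2 ⊢
    omega
  · simp [Move.removed, Move.added, upper, upperWeight_one, upperWeight_three,
      upperWeight_five] at h1 h2 ⊢
    omega
  · simp [Move.removed, Move.added, upper, upperWeight_eight, upperWeight_two,
      upperWeight_five] at h1 h2 ⊢
    omega
  · have h4 : upperWeight (F (k + 3)) + upperWeight (F (k + 6)) ≤ upperWeight (F (k + 5)) +
      upperWeight (F (k + 5)) := by
      rw [show k + 6 = (k + 1) + 5 by omega, upperWeight_F_add_five, upperWeight_F_add_five]
      rcases k with _ | _ | k
      · decide
      · decide
      · rw [show k + 1 + 1 + 3 = k + 5 by omega,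
          upperWeight_F_add_five]; split_ifs <;> simp at * <;> omega
    simp [Move.removed, Move.added, upper, h3'] at h1 h2 ⊢
    simp only [add_assoc, Nat.reduceAdd] at h1 h2
    omega

theorem playable_C_one {s : Multiset ℕ} : Playable s (.C 1) ↔ 2 ≤ s.count 1 := by
  rw [Multiset.le_count_iff_replicate_le]
  simp [Playable, Move.Valid, Move.removed, Multiset.replicate_succ]

theorem playable_S_two {s : Multiset ℕ} : Playable s (.S 2) ↔ 2 ≤ s.count 2 := by
  rw [Multiset.le_count_iff_replicate_le]
  simp [Playable, Move.Valid, Move.removed, Multiset.replicate_succ]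

theorem playable_C_two {s : Multiset ℕ} : Playable s (.C 2) ↔ 1 ≤ s.count 1 ∧ 1 ≤ s.count 2 := by
  simp only [Playable, Move.Valid, Move.removed, Multiset.le_iff_count]
  constructor
  · rintro ⟨-, h⟩
    exact ⟨by simpa using h 1, by simpa using h 2⟩
  · rintro ⟨h1, h2⟩
    refine ⟨by norm_num, fun v => ?_⟩
    by_cases hv : v = 1
    · subst hv; simpa using h1
    · by_cases hv2 : v = 2
      · subst hv2; simpa using h2
      · simp [Multiset.insert_eq_cons, hv, hv2]

theorem count_play_C_one {s : Multiset ℕ} (h : Playable s (.C 1)) :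
    (play s (.C 1)).count 1 + 2 = s.count 1 ∧ (play s (.C 1)).count 2 = s.count 2 + 1 := by
  have h1 := count_play h 1
  have h2 := count_play h 2
  simpa [Move.removed, Move.added, Multiset.count_cons,
      Multiset.count_singleton] using And.intro h1 h2

theorem count_play_S_two {s : Multiset ℕ} (h : Playable s (.S 2)) :
    (play s (.S 2)).count 1 = s.count 1 + 1 ∧ (play s (.S 2)).count 2 + 2 = s.count 2 := by
  have h1 := count_play h 1
  have h2 := count_play h 2
  simpa [Move.removed, Move.added, Multiset.count_cons,
      Multiset.count_singleton] using And.intro h1 h2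

/-! ### Routes of different lengths between the same positions -/

/-- Two routes between the same positions, of lengths one and two. -/
theorem play_C_one_S_two {s : Multiset ℕ} (h1 : Playable s (.C 1)) (h2 : Playable (play s (.C 1))
    (.S 2))
    (h3 : Playable s (.C 2)) : play (play s (.C 1)) (.S 2) = play s (.C 2) := by
  have e1 := play_add_removed h1
  have e2 := play_add_removed h2
  have e3 := play_add_removed h3
  ext v
  have f1 := congrArg (Multiset.count v) e1
  have f2 := congrArg (Multiset.count v) e2
  have f3 := congrArg (Multiset.count v) e3
  simp [Move.removed, Move.added, Multiset.insert_eq_cons, Multiset.count_cons,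
      Multiset.count_singleton] at f1 f2 f3
  omega

theorem play_S_two_C_one {s : Multiset ℕ} (h1 : Playable s (.S 2)) (h2 : Playable (play s (.S 2))
    (.C 1))
    (h3 : Playable s (.C 2)) : play (play s (.S 2)) (.C 1) = play s (.C 2) := by
  have e1 := play_add_removed h1
  have e2 := play_add_removed h2
  have e3 := play_add_removed h3
  ext v
  have f1 := congrArg (Multiset.count v) e1
  have f2 := congrArg (Multiset.count v) e2
  have f3 := congrArg (Multiset.count v) e3
  simp [Move.removed, Move.added, Multiset.insert_eq_cons, Multiset.count_cons,
      Multiset.count_singleton] at f1 f2 f3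
  omega

/-! ### Random moves: contraction of the character sum -/

/-- The expectation of `ω ^ length` over the games from `s` with uniformly random moves. -/
noncomputable def randomCharSum (ω : ℂ) (s : Multiset ℕ) : ℂ :=
  ∑ l ∈ games s, ((stepWeight s l).toReal : ℂ) * ω ^ l.length

theorem randomCharSum_of_terminal (ω : ℂ) {s : Multiset ℕ} (h : moves s = ∅) :
    randomCharSum ω s = 1 := by
  simp [randomCharSum, sum_games_of_terminal h, stepWeight]

theorem randomCharSum_step (ω : ℂ) {s : Multiset ℕ} (h : (moves s).Nonempty) :
    randomCharSum ω s
      = (numPlayable s : ℂ)⁻¹ * ω * ∑ m ∈ moves s, randomCharSum ω (play s m) := by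
  rw [randomCharSum, sum_games h, Finset.mul_sum]
  refine Finset.sum_congr rfl fun m _ => ?_
  rw [randomCharSum, Finset.mul_sum]
  refine Finset.sum_congr rfl fun l _ => ?_
  simp only [stepWeight, ENNReal.toReal_mul, ENNReal.toReal_inv, ENNReal.toReal_natCast,
    Complex.ofReal_mul, Complex.ofReal_inv, Complex.ofReal_natCast, List.length_cons]
  ring

theorem norm_randomCharSum_step {ω : ℂ} (hω : ‖ω‖ = 1) {s : Multiset ℕ} (h : (moves s).Nonempty) :
    ‖randomCharSum ω s‖
      = (numPlayable s : ℝ)⁻¹ * ‖∑ m ∈ moves s, randomCharSum ω (play s m)‖ := by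
  rw [randomCharSum_step ω h, norm_mul, norm_mul, hω, mul_one, norm_inv, Complex.norm_natCast]

theorem one_le_numPlayable {s : Multiset ℕ} {m : Move} (h : Playable s m) : 1 ≤ numPlayable s := by
  rw [← card_moves]
  exact Finset.card_pos.2 ⟨m, mem_moves.2 h⟩

theorem norm_randomCharSum_le_one {ω : ℂ} (hω : ‖ω‖ = 1) (s : Multiset ℕ) :
    ‖randomCharSum ω s‖ ≤ 1 := by
  induction hn : potential s using Nat.strong_induction_on generalizing s with
  | _ n ih =>
    subst hn
    rcases (moves s).eq_empty_or_nonempty with h | h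
    · simp [randomCharSum_of_terminal ω h]
    · have hpos : (0 : ℝ) < numPlayable s := by
        rw [← card_moves]
        exact_mod_cast h.card_pos
      rw [norm_randomCharSum_step hω h, inv_mul_le_one₀ hpos]
      refine (norm_sum_le_of_le _ fun m hm =>
        ih _ (potential_play_lt (mem_moves.1 hm)) _ rfl).trans ?_
      simp [card_moves]

/-- Keeping one term, or below a pair of terms, out of the triangle inequality lets a gain found
deeper in the game tree pass to the sum above it. -/
theorem norm_sum_le_one_special {ι E : Type*} [DecidableEq ι] [SeminormedAddCommGroup E]
    {M : Finset ι} {g : ι → E} {a : ℝ} (h : ∀ m ∈ M, ‖g m‖ ≤ a) {m₀ : ι} (h₀ : m₀ ∈ M) :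
    ‖∑ m ∈ M, g m‖ ≤ (M.card - 1) * a + ‖g m₀‖ := by
  rw [← Finset.add_sum_erase M g h₀, add_comm]
  refine (norm_add_le _ _).trans (add_le_add_left ?_ _)
  refine (norm_sum_le_of_le _ fun m hm => h m (Finset.mem_of_mem_erase hm)).trans ?_
  rw [Finset.sum_const, nsmul_eq_mul, Finset.cast_card_erase_of_mem h₀]

theorem norm_sum_le_two_special {ι E : Type*} [DecidableEq ι] [SeminormedAddCommGroup E]
    {M : Finset ι} {g : ι → E} {a : ℝ} (h : ∀ m ∈ M, ‖g m‖ ≤ a) {m₀ m₁ : ι} (h₀ : m₀ ∈ M)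
    (h₁ : m₁ ∈ M) (hne : m₁ ≠ m₀) :
    ‖∑ m ∈ M, g m‖ ≤ (M.card - 2) * a + ‖g m₀ + g m₁‖ := by
  have h₁' : m₁ ∈ M.erase m₀ := Finset.mem_erase.2 ⟨hne, h₁⟩
  rw [← Finset.add_sum_erase M g h₀, ← Finset.add_sum_erase _ g h₁', ← add_assoc, add_comm]
  refine (norm_add_le _ _).trans (add_le_add_left ?_ _)
  refine (norm_sum_le_of_le _ fun m hm =>
    h m (Finset.mem_of_mem_erase (Finset.mem_of_mem_erase hm))).trans ?_
  rw [Finset.sum_const, nsmul_eq_mul, Finset.cast_card_erase_of_mem h₁',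
    Finset.cast_card_erase_of_mem h₀]
  linarith

/-- `1 + ω / n` is the convex combination of `1` and `1 + ω` with weights `1 - 1 / n` and `1 / n`.
-/
theorem norm_one_add_div_le {ω : ℂ} {n : ℕ} (hn : 1 ≤ n) :
    ‖1 + (n : ℂ)⁻¹ * ω‖ ≤ 1 - (n : ℝ)⁻¹ + (n : ℝ)⁻¹ * ‖1 + ω‖ := by
  have h1 : (n : ℝ)⁻¹ ≤ 1 := inv_le_one_of_one_le₀ (by exact_mod_cast hn)
  have e : 1 + (n : ℂ)⁻¹ * ω = ((1 - (n : ℝ)⁻¹ : ℝ) : ℂ) + (n : ℂ)⁻¹ * (1 + ω) := by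
    push_cast; ring
  rw [e]
  refine (norm_add_le _ _).trans (le_of_eq ?_)
  rw [norm_mul, norm_inv, Complex.norm_natCast, Complex.norm_real,
      Real.norm_of_nonneg (by linarith)]

theorem norm_one_add_le_two {ω : ℂ} (hω : ‖ω‖ = 1) : ‖1 + ω‖ ≤ 2 := by
  refine (norm_add_le _ _).trans ?_
  rw [hω, norm_one]; norm_num

/-- As long as there are enough tokens `F 1`, the two routes `C 1, C 2` and `C 1, C 1, S 2`
contract the character sum. -/
theorem norm_randomCharSum_le {ω : ℂ} (hω : ‖ω‖ = 1) {K N : ℕ}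
    (hK : ∀ s : Multiset ℕ, s.sum = N → numPlayable s ≤ K) (j : ℕ) (s : Multiset ℕ)
    (hs : s.sum = N) (hj : 6 * j ≤ s.count 1) :
    ‖randomCharSum ω s‖ ≤ (1 - (2 - ‖1 + ω‖) / 2 / (K : ℝ) ^ 3) ^ j := by
  induction j generalizing s with
  | zero => simpa using norm_randomCharSum_le_one hω s
  | succ j ih =>
    set δ : ℝ := (2 - ‖1 + ω‖) / 2 with hδ
    have hδ0 : 0 ≤ δ := by have := norm_one_add_le_two hω; rw [hδ]; linarith
    have hδ1 : δ ≤ 1 := by have := norm_nonneg (1 + ω); rw [hδ]; linarith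
    set s₁ := play s (.C 1) with hs₁
    set s₂ := play s₁ (.C 1) with hs₂
    -- The initial `C 1` guarantees an `F 2`, so that `C 2` is playable at `s₁`.
    have p0 : Playable s (.C 1) := playable_C_one.2 (by omega)
    have c0 := count_play_C_one p0
    rw [← hs₁] at c0
    have p1 : Playable s₁ (.C 1) := playable_C_one.2 (by omega)
    have q1 : Playable s₁ (.C 2) := playable_C_two.2 (by omega)
    have c1 := count_play_C_one p1
    rw [← hs₂] at c1
    have p2 : Playable s₂ (.S 2) := playable_S_two.2 (by omega)
    have et : play s₂ (.S 2) = play s₁ (.C 2) := play_C_one_S_two p1 p2 q1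
    have sum1 : s₁.sum = N := by rw [hs₁, sum_play p0, hs]
    have sum2 : s₂.sum = N := by rw [hs₂, sum_play p1, sum1]
    have K1 : 1 ≤ K := (one_le_numPlayable p0).trans (hK s hs)
    have K3 : (1 : ℝ) ≤ (K : ℝ) ^ 3 := one_le_pow₀ (by exact_mod_cast K1)
    set θ : ℝ := 1 - δ / (K : ℝ) ^ 3 with hθ
    have hθ0 : 0 ≤ θ := by
      have : δ / (K : ℝ) ^ 3 ≤ 1 := (div_le_one (by linarith)).2 (by linarith)
      rw [hθ]; linarith
    set a : ℝ := θ ^ j with ha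
    have ha0 : 0 ≤ a := pow_nonneg hθ0 j
    -- A block looks at most three moves ahead and each move removes at most two `F 1`, so at least
    -- `6 * j` are left for the induction hypothesis.
    have b0 : ∀ m ∈ moves s, ‖randomCharSum ω (play s m)‖ ≤ a := fun m hm => by
      have hm := mem_moves.1 hm
      have := count_le_count_play hm 1
      exact ih _ (by rw [sum_play hm, hs]) (by omega)
    have b1 : ∀ m ∈ moves s₁, ‖randomCharSum ω (play s₁ m)‖ ≤ a := fun m hm => by
      have hm := mem_moves.1 hm
      have := count_le_count_play hm 1
      exact ih _ (by rw [sum_play hm, sum1]) (by omega)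
    have b2 : ∀ m ∈ moves s₂, ‖randomCharSum ω (play s₂ m)‖ ≤ a := fun m hm => by
      have hm := mem_moves.1 hm
      have := count_le_count_play hm 1
      exact ih _ (by rw [sum_play hm, sum2]) (by omega)
    have n0 := one_le_numPlayable p0
    have n1 := one_le_numPlayable p1
    have n2 := one_le_numPlayable p2
    have i2 : (numPlayable s₂ : ℝ)⁻¹ * numPlayable s₂ = 1 := inv_mul_cancel₀ (by positivity)
    have i1 : (numPlayable s₁ : ℝ)⁻¹ * numPlayable s₁ = 1 := inv_mul_cancel₀ (by positivity)
    have i0 : (numPlayable s : ℝ)⁻¹ * numPlayable s = 1 := inv_mul_cancel₀ (by positivity)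
    have r0 : 0 ≤ (numPlayable s : ℝ)⁻¹ := by positivity
    have r1 : 0 ≤ (numPlayable s₁ : ℝ)⁻¹ := by positivity
    have r2 : 0 ≤ (numPlayable s₂ : ℝ)⁻¹ := by positivity
    -- `C 2` from `s₁` and `S 2` from `s₂` reach the same position, so its character sum occurs with
    -- coefficient `1 + ω / numPlayable s₂`.
    have pair : ‖randomCharSum ω (play s₁ (.C 2)) + randomCharSum ω s₂‖
        ≤ (2 - 2 * (δ * (numPlayable s₂ : ℝ)⁻¹)) * a := by
      rw [randomCharSum_step ω ⟨_, mem_moves.2 p2⟩,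
        ← Finset.add_sum_erase _ _ (mem_moves.2 p2), et]
      set R := ∑ m ∈ (moves s₂).erase (.S 2), randomCharSum ω (play s₂ m) with hR
      set E := randomCharSum ω (play s₁ (.C 2)) with hE
      have hEa : ‖E‖ ≤ a := b1 _ (mem_moves.2 q1)
      have hRa : ‖R‖ ≤ ((numPlayable s₂ : ℝ) - 1) * a := by
        refine (norm_sum_le_of_le _ fun m hm => b2 m (Finset.mem_of_mem_erase hm)).trans ?_
        rw [Finset.sum_const, nsmul_eq_mul, Finset.cast_card_erase_of_mem (mem_moves.2 p2),
          card_moves]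
      have e : E + (numPlayable s₂ : ℂ)⁻¹ * ω * (E + R)
          = (1 + (numPlayable s₂ : ℂ)⁻¹ * ω) * E + (numPlayable s₂ : ℂ)⁻¹ * ω * R := by ring
      rw [e]
      refine (norm_add_le _ _).trans ?_
      rw [norm_mul, norm_mul, norm_mul, hω, mul_one, norm_inv, Complex.norm_natCast]
      have f1 := mul_le_mul (norm_one_add_div_le (ω := ω) n2) hEa (norm_nonneg _)
        ((norm_nonneg _).trans (norm_one_add_div_le (ω := ω) n2))
      have f2 := mul_le_mul_of_nonneg_left hRa r2
      have f3 : (numPlayable s₂ : ℝ)⁻¹ * (((numPlayable s₂ : ℝ) - 1) * a)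
          = (1 - (numPlayable s₂ : ℝ)⁻¹) * a := by
        rw [← mul_assoc, mul_sub, i2, mul_one]
      have f4 : ‖1 + ω‖ = 2 - 2 * δ := by rw [hδ]; ring
      rw [f3] at f2
      rw [f4] at f1
      linarith
    have first : ‖randomCharSum ω s₁‖
        ≤ (1 - 2 * (δ * (numPlayable s₂ : ℝ)⁻¹) * (numPlayable s₁ : ℝ)⁻¹) * a := by
      rw [norm_randomCharSum_step hω ⟨_, mem_moves.2 p1⟩]
      have g := norm_sum_le_two_special b1 (mem_moves.2 q1) (mem_moves.2 p1) (by simp)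
      rw [card_moves] at g
      have g2 := mul_le_mul_of_nonneg_left (g.trans (add_le_add_right pair _)) r1
      refine g2.trans (le_of_eq ?_)
      linear_combination a * i1
    have zero : ‖randomCharSum ω s‖
        ≤ (1 - 2 * (δ * (numPlayable s₂ : ℝ)⁻¹) * (numPlayable s₁ : ℝ)⁻¹
            * (numPlayable s : ℝ)⁻¹) * a := by
      rw [norm_randomCharSum_step hω ⟨_, mem_moves.2 p0⟩]
      have g := norm_sum_le_one_special b0 (mem_moves.2 p0)
      rw [card_moves] at g
      have g2 := mul_le_mul_of_nonneg_left (g.trans (add_le_add_right first _)) r0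
      refine g2.trans (le_of_eq ?_)
      linear_combination a * i0
    rw [pow_succ, mul_comm]
    refine zero.trans (mul_le_mul_of_nonneg_right ?_ ha0)
    -- The gain carries one reciprocal for each of `s`, `s₁`, `s₂`, each at least `1 / K`; a spare
    -- factor 2 is dropped.
    have inv_le : ∀ u : Multiset ℕ, u.sum = N → 1 ≤ numPlayable u →
        (K : ℝ)⁻¹ ≤ (numPlayable u : ℝ)⁻¹ := fun u hu h1 =>
      inv_anti₀ (by exact_mod_cast h1) (by exact_mod_cast hK u hu)
    have k0 : (0 : ℝ) ≤ (K : ℝ)⁻¹ := by positivity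
    have h3 : (K : ℝ)⁻¹ * (K : ℝ)⁻¹ * (K : ℝ)⁻¹
        ≤ (numPlayable s₂ : ℝ)⁻¹ * (numPlayable s₁ : ℝ)⁻¹ * (numPlayable s : ℝ)⁻¹ :=
      mul_le_mul (mul_le_mul (inv_le _ sum2 n2) (inv_le _ sum1 n1) k0 r2) (inv_le _ hs n0) k0
        (mul_nonneg r2 r1)
    have h4 : δ / (K : ℝ) ^ 3 = δ * ((K : ℝ)⁻¹ * (K : ℝ)⁻¹ * (K : ℝ)⁻¹) := by
      rw [div_eq_mul_inv, ← inv_pow]; ring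
    have h5 := mul_le_mul_of_nonneg_left h3 hδ0
    have h6 : 0 ≤ δ * ((K : ℝ)⁻¹ * (K : ℝ)⁻¹ * (K : ℝ)⁻¹) := by positivity
    rw [hθ, h4]
    linarith

/-! ### The number of playable moves is logarithmic -/

theorem two_pow_le_fib (m : ℕ) : 2 ^ m ≤ Nat.fib (2 * m + 1) := by
  induction m with
  | zero => simp
  | succ m ih =>
    have h1 : Nat.fib (2 * (m + 1) + 1) = Nat.fib (2 * m + 1) + Nat.fib (2 * m + 2) :=
      Nat.fib_add_two
    have h2 : Nat.fib (2 * m + 1) ≤ Nat.fib (2 * m + 2) := Nat.fib_mono (by omega)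
    rw [pow_succ]
    omega

theorem index_le_of_F_le {k N : ℕ} (h : F k ≤ N) : k ≤ 2 * Nat.log 2 N + 1 := by
  have h1 : 2 ^ (k / 2) ≤ N :=
    (two_pow_le_fib _).trans ((Nat.fib_mono (by omega)).trans h)
  have h2 := Nat.le_log_of_pow_le (by norm_num) h1
  omega

/-- A playable `C k` or `S k` removes a token `F k`, which is at most the sum of the position, and
`F` grows exponentially. -/
theorem numPlayable_le (s : Multiset ℕ) : numPlayable s ≤ 4 * Nat.log 2 s.sum + 4 := by
  set B := 2 * Nat.log 2 s.sum + 2 with hB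
  have hsub : moves s ⊆ (Finset.range B).image Move.C ∪ (Finset.range B).image Move.S := by
    intro m hm
    have hm := mem_moves.1 hm
    have key : ∀ k, F k ∈ s → k < B := fun k hk => by
      have := index_le_of_F_le (Multiset.le_sum_of_mem hk)
      omega
    simp only [Finset.mem_union, Finset.mem_image, Finset.mem_range]
    rcases m with k | k
    · refine Or.inl ⟨k, key k (Multiset.mem_of_le hm.2 ?_), rfl⟩
      by_cases h : k = 1 <;> simp [Move.removed, h]
    · exact Or.inr ⟨k, key k (Multiset.mem_of_le hm.2 (by simp [Move.removed])), rfl⟩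
  rw [← card_moves]
  refine (Finset.card_le_card hsub).trans ((Finset.card_union_le _ _).trans ?_)
  have h1 := Finset.card_image_le (s := Finset.range B) (f := Move.C)
  have h2 := Finset.card_image_le (s := Finset.range B) (f := Move.S)
  simp only [Finset.card_range] at h1 h2
  omega

/-! ### Uniform games: a bound by the number of trades -/

/-- The sum of `ω ^ length` over the games from `s`. -/
noncomputable def charSum (ω : ℂ) (s : Multiset ℕ) : ℂ := ∑ l ∈ games s, ω ^ l.length

theorem charSum_step (ω : ℂ) {s : Multiset ℕ} (h : (moves s).Nonempty) :
    charSum ω s = ∑ m ∈ moves s, ω * charSum ω (play s m) := by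
  rw [charSum, sum_games h]
  refine Finset.sum_congr rfl fun m _ => ?_
  rw [charSum, Finset.mul_sum]
  exact Finset.sum_congr rfl fun l _ => by rw [List.length_cons, pow_succ']

open Classical in
/-- The number of moves `C 2` of `l` that are played when they can be traded for `C 1, S 2` (in the
first phase, `b = false`, which ends when fewer than three tokens `F 1` are left) or for `S 2, C 1`
(in the second phase). -/
noncomputable def trades : Bool → Multiset ℕ → List Move → ℕ
  | _, _, [] => 0
  | b, s, m :: l =>
    (if m = .C 2 ∧ (if b then 2 ≤ s.count 2 else 3 ≤ s.count 1) then 1 else 0)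
      + trades (b || decide (s.count 1 < 3)) (play s m) l

/-- The sum of `κ ^ trades` over the games from `s`. -/
noncomputable def tradeSum (κ : ℝ) (b : Bool) (s : Multiset ℕ) : ℝ :=
  ∑ l ∈ games s, κ ^ trades b s l

theorem tradeSum_step (κ : ℝ) (b : Bool) {s : Multiset ℕ} (h : (moves s).Nonempty) :
    tradeSum κ b s = ∑ m ∈ moves s,
      κ ^ (if m = .C 2 ∧ (if b then 2 ≤ s.count 2 else 3 ≤ s.count 1) then 1 else 0)
        * tradeSum κ (b || decide (s.count 1 < 3)) (play s m) := by
  rw [tradeSum, sum_games h]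
  refine Finset.sum_congr rfl fun m _ => ?_
  rw [tradeSum, Finset.mul_sum]
  exact Finset.sum_congr rfl fun l _ => by rw [trades, pow_add]

/-- The first move of the alternative to `C 2` in each phase. -/
def detour : Bool → Move
  | false => .C 1
  | true => .S 2

/-- The second move of the alternative to `C 2` in each phase. -/
def detourEnd : Bool → Move
  | false => .S 2
  | true => .C 1

theorem detour_spec {b : Bool} {s : Multiset ℕ} (h : Playable s (.C 2))
    (hb : if b then 2 ≤ s.count 2 else 3 ≤ s.count 1) :
    Playable s (detour b) ∧ Playable (play s (detour b)) (detourEnd b) ∧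
      play (play s (detour b)) (detourEnd b) = play s (.C 2) ∧
      (b || decide (s.count 1 < 3)) = b := by
  have h' := playable_C_two.1 h
  cases b
  · simp only [Bool.false_eq_true, if_false] at hb
    have p : Playable s (.C 1) := playable_C_one.2 (by omega)
    have c := count_play_C_one p
    have q : Playable (play s (.C 1)) (.S 2) := playable_S_two.2 (by omega)
    exact ⟨p, q, play_C_one_S_two p q h, by simp; omega⟩
  · simp only [if_true] at hb
    have p : Playable s (.S 2) := playable_S_two.2 hb
    have c := count_play_S_two p
    have q : Playable (play s (.S 2)) (.C 1) := playable_C_one.2 (by omega)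
    exact ⟨p, q, play_S_two_C_one p q h, by simp⟩

/-- At a trade site the `C 2` branch is paired with the detour branch, giving norm `2 * κ` times
that of the common continuation: one `κ` is the factor of the trade, the other is bounded by 1. The
pairing uses up the `detourEnd b` branch after the detour, so the induction must also bound the sum
without it. Fixing one order of the detour per phase keeps `detour b` available in that sum. -/
theorem norm_charSum_le_tradeSum_aux {ω : ℂ} (hω : ‖ω‖ = 1) {κ : ℝ} (hκ : ‖1 + ω‖ = 2 * κ)
    (hκ0 : 0 ≤ κ) (hκ1 : κ ≤ 1) (s : Multiset ℕ) (b : Bool) :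
    ‖charSum ω s‖ ≤ tradeSum κ b s ∧
    ‖∑ m ∈ (moves s).erase (detourEnd b), ω * charSum ω (play s m)‖ ≤
      ∑ m ∈ (moves s).erase (detourEnd b),
      κ ^ (if m = .C 2 ∧ (if b then 2 ≤ s.count 2 else 3 ≤ s.count 1) then 1 else 0)
        * tradeSum κ (b || decide (s.count 1 < 3)) (play s m) := by
  induction hn : potential s using Nat.strong_induction_on generalizing s b with
  | _ n ih =>
    subst hn
    set b' := b || decide (s.count 1 < 3) with hb'
    set w : Move → ℝ := fun m =>
      κ ^ (if m = .C 2 ∧ (if b then 2 ≤ s.count 2 else 3 ≤ s.count 1) then 1 else 0)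
        * tradeSum κ b' (play s m) with hw
    have term : ∀ m ∈ moves s, ∀ c : Bool, ‖ω * charSum ω (play s m)‖ ≤ tradeSum κ c (play s m) :=
      fun m hm c => by
        rw [norm_mul, hω, one_mul]
        exact (ih _ (potential_play_lt (mem_moves.1 hm)) _ c rfl).1
    -- Used for all moves and for all but `detourEnd b`; only the presence of `detour b` beside `C
    -- 2` matters.
    have main : ∀ A ⊆ moves s, (.C 2 ∈ A → Playable s (detour b) → detour b ∈ A) →
        ‖∑ m ∈ A, ω * charSum ω (play s m)‖ ≤ ∑ m ∈ A, w m := by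
      intro A hA hAd
      by_cases hsite : (.C 2 : Move) ∈ A ∧ (if b then 2 ≤ s.count 2 else 3 ≤ s.count 1)
      · obtain ⟨hC, hcond⟩ := hsite
        have hCp := mem_moves.1 (hA hC)
        obtain ⟨p, q, et, hbb⟩ := detour_spec hCp hcond
        have hne : detour b ≠ .C 2 := by cases b <;> simp [detour]
        have hne' : detourEnd b ≠ .C 2 := by cases b <;> simp [detourEnd]
        have hD : detour b ∈ A.erase (.C 2) := Finset.mem_erase.2 ⟨hne, hAd hC p⟩
        rw [← Finset.add_sum_erase A _ hC, ← Finset.add_sum_erase A w hC,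
          ← Finset.add_sum_erase _ _ hD, ← Finset.add_sum_erase _ w hD]
        have rest : ‖∑ m ∈ (A.erase (.C 2)).erase (detour b), ω * charSum ω (play s m)‖
            ≤ ∑ m ∈ (A.erase (.C 2)).erase (detour b), w m := by
          refine norm_sum_le_of_le _ fun m hm => ?_
          have hm2 : m ≠ .C 2 := Finset.ne_of_mem_erase (Finset.mem_of_mem_erase hm)
          have hm3 := hA (Finset.mem_of_mem_erase (Finset.mem_of_mem_erase hm))
          simpa [hw, hm2] using term m hm3 b'
        have hq : (moves (play s (detour b))).Nonempty := ⟨_, mem_moves.2 q⟩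
        have wC : w (.C 2) = κ * tradeSum κ b' (play s (.C 2)) := by simp [hw, hcond]
        have wD : w (detour b) = tradeSum κ b (play s (detour b)) := by
          simp [hw, hne, hb', hbb]
        rw [wC, wD, charSum_step ω hq, tradeSum_step κ b hq,
          ← Finset.add_sum_erase _ _ (mem_moves.2 q), ← Finset.add_sum_erase _ _ (mem_moves.2 q),
              et]
        have excl := (ih _ (potential_play_lt p) _ b rfl).2
        set c := (b || decide ((play s (detour b)).count 1 < 3))
        set R := ∑ m ∈ (moves (play s (detour b))).erase (detourEnd b),
          ω * charSum ω (play (play s (detour b)) m)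
        set t := play s (.C 2) with ht
        have hpot : potential t < potential s := potential_play_lt hCp
        have t1 := (ih _ hpot t b' rfl).1
        have t2 := (ih _ hpot t c rfl).1
        have e : ∀ Q : ℂ, ω * charSum ω t + (ω * (ω * charSum ω t + R) + Q)
            = ω * ((1 + ω) * charSum ω t) + ω * R + Q := fun Q => by ring
        rw [e]
        refine (norm_add₃_le).trans ?_
        rw [norm_mul, norm_mul, norm_mul, hω, hκ, one_mul, one_mul]
        have u1 : κ * ‖charSum ω t‖ ≤ κ * tradeSum κ b' t := mul_le_mul_of_nonneg_left t1 hκ0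
        have u2 : κ * ‖charSum ω t‖ ≤ tradeSum κ c t :=
          (mul_le_of_le_one_left (norm_nonneg _) hκ1).trans t2
        simp only [hne', false_and, if_false, pow_zero, one_mul]
        linarith
      · refine norm_sum_le_of_le _ fun m hm => ?_
        have : ¬ (m = .C 2 ∧ (if b then 2 ≤ s.count 2 else 3 ≤ s.count 1)) := by
          rintro ⟨rfl, h⟩
          exact hsite ⟨hm, h⟩
        simpa [hw, this] using term m (hA hm) b'
    constructor
    · rcases (moves s).eq_empty_or_nonempty with h | h
      · simp [charSum, tradeSum, sum_games_of_terminal h, trades]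
      · rw [charSum_step ω h, tradeSum_step κ b h]
        exact main _ subset_rfl fun _ hp => mem_moves.2 hp
    · refine main _ (Finset.erase_subset _ _) fun _ hp => Finset.mem_erase.2 ⟨?_, mem_moves.2 hp⟩
      cases b <;> simp [detour, detourEnd]

/-- Averaging over the possible trades. -/
theorem norm_charSum_le_tradeSum {ω : ℂ} (hω : ‖ω‖ = 1) (s : Multiset ℕ) :
    ‖charSum ω s‖ ≤ tradeSum (‖1 + ω‖ / 2) false s := by
  have := norm_one_add_le_two hω
  exact (norm_charSum_le_tradeSum_aux hω (by ring) (by positivity) (by linarith) s false).1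

/-! ### Counting moves along a game -/

/-- The position after the moves of `l`. -/
def after (s : Multiset ℕ) (l : List Move) : Multiset ℕ := l.foldl play s

@[simp] theorem after_nil (s : Multiset ℕ) : after s [] = s := rfl
@[simp] theorem after_cons (s : Multiset ℕ) (m : Move) (l : List Move) :
    after s (m :: l) = after (play s m) l := rfl

theorem not_playable_after {s : Multiset ℕ} {l : List Move} (h : IsGameFrom s l) (m : Move) :
    ¬ Playable (after s l) m := by
  induction l generalizing s with
  | nil => exact h m
  | cons a l ih => exact ih h.2

theorem length_le_potential {s : Multiset ℕ} {l : List Move} (h : IsGameFrom s l) :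
    l.length ≤ potential s := by
  induction l generalizing s with
  | nil => simp
  | cons a l ih =>
    have h1 := ih h.2
    have h2 := potential_play_lt h.1
    simp only [List.length_cons]
    omega

theorem count_one_take {s : Multiset ℕ} {l : List Move} (h : IsGameFrom s l) (k : ℕ) :
    s.count 1 ≤ (after s (l.take k)).count 1 + 2 * (l.take k).count (.C 1)
      + (l.take k).count (.C 2) := by
  induction l generalizing s k with
  | nil => simp
  | cons a l ih =>
    rcases k with _ | k
    · simp
    · have h1 := ih h.2 k
      have h2 := count_one_step h.1
      simp only [List.take_succ_cons, after_cons, List.count_cons, beq_iff_eq]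
      split_ifs at h2 ⊢ <;> omega

theorem count_two_take {s : Multiset ℕ} {l : List Move} (h : IsGameFrom s l) (k : ℕ) :
    (l.take k).count (.C 1) + s.count 2 ≤ (after s (l.take k)).count 2 + upper s
      + 6 * (l.take k).count (.C 2) + 7 * (l.take k).count (.S 2) := by
  suffices (l.take k).count (.C 1) + upper (after s (l.take k)) + s.count 2 ≤
      (after s (l.take k)).count 2 + upper s
      + 6 * (l.take k).count (.C 2) + 7 * (l.take k).count (.S 2) by omega
  induction l generalizing s k with
  | nil => simp [add_comm]
  | cons a l ih =>
    rcases k with _ | k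
    · simp [add_comm]
    · have h1 := ih h.2 k
      have h2 := count_two_step h.1
      simp only [List.take_succ_cons, after_cons, List.count_cons, beq_iff_eq]
      split_ifs at h2 ⊢ <;> omega

/-- The phase changes only after the move at the first position with fewer than three `F 1`. A `C 2`
played right there is judged by the first rule and missed: this is the extra 1. -/
theorem count_C_two_le_trades_add (b : Bool) (s : Multiset ℕ) (l : List Move) (e : ℕ)
    (h : ∀ k < e, 2 ≤ (after s (l.take k)).count 2) :
    (l.take e).count (.C 2) ≤ trades b s l + (if b then 0 else 1) := by
  induction l generalizing b s e with
  | nil => simp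
  | cons a l ih =>
    rcases e with _ | e
    · simp
    · have h0 : 2 ≤ s.count 2 := by simpa using h 0 (by omega)
      have h1 := ih (b || decide (s.count 1 < 3)) (play s a) e fun k hk => by
        simpa using h (k + 1) (by omega)
      simp only [List.take_succ_cons, List.count_cons, beq_iff_eq, trades]
      cases b
      · by_cases h3 : s.count 1 < 3
        · simp only [h3, decide_true, Bool.or_true, if_true] at h1 ⊢
          split_ifs <;> simp_all <;> omega
        · have h3' : 3 ≤ s.count 1 := by omega
          simp [h3, h3'] at h1 ⊢
          omega
      · simp [h0] at h1 ⊢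
        omega

theorem count_C_two_le_trades (s : Multiset ℕ) (l : List Move) (t e : ℕ)
    (ht : ∀ k < t, 3 ≤ (after s (l.take k)).count 1)
    (he : ∀ k, t ≤ k → k < e → 2 ≤ (after s (l.take k)).count 2) :
    (l.take e).count (.C 2) ≤ trades false s l + 1 := by
  induction l generalizing s t e with
  | nil => simp
  | cons a l ih =>
    rcases t with _ | t
    · simpa using count_C_two_le_trades_add false s (a :: l) e fun k hk => he k (by omega) hk
    · rcases e with _ | e
      · simp
      · have h0 : 3 ≤ s.count 1 := by simpa using ht 0 (by omega)
        have h1 := ih (play s a) t e (fun k hk => by simpa using ht (k + 1) (by omega))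
          fun k hk hk' => by simpa using he (k + 1) (by omega) (by omega)
        simp only [List.take_succ_cons, List.count_cons, beq_iff_eq, trades]
        simp [h0, show ¬ s.count 1 < 3 by omega]
        omega

theorem count_take_mono {α : Type*} [BEq α] (l : List α) (a : α) {i j : ℕ} (h : i ≤ j) :
    (l.take i).count a ≤ (l.take j).count a := by
  rw [show l.take i = (l.take j).take i by rw [List.take_take, min_eq_left h]]
  exact (List.take_sublist _ _).count_le _

theorem count_take_succ {α : Type*} [DecidableEq α] (l : List α) (a : α) (k : ℕ) :
    (l.take (k + 1)).count a = (l.take k).count a + if l[k]? = some a then 1 else 0 := by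
  rw [List.take_add_one, List.count_append]
  congr 1
  rcases l[k]? with _ | b
  · simp
  · simp [List.count_singleton]

/-- The indices in `[a, b)` at which `l` has the entry `m`. -/
noncomputable def indices (l : List Move) (m : Move) (a b : ℕ) : Finset ℕ :=
  (Finset.Ico a b).filter fun k => l[k]? = some m

theorem card_indices (l : List Move) (m : Move) {a b : ℕ} (h : a ≤ b) :
    (indices l m a b).card + (l.take a).count m = (l.take b).count m := by
  induction b, h using Nat.le_induction with
  | base => simp [indices]
  | succ b h ih =>
    rw [count_take_succ, ← ih, indices, ← Finset.insert_Ico_right_eq_Ico_add_one h,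
      Finset.filter_insert]
    split_ifs
    · rw [Finset.card_insert_of_notMem (by simp), indices]; omega
    · rw [indices]; omega

theorem exists_count_take_eq {α : Type*} [DecidableEq α] (l : List α) (a : α) {q n : ℕ}
    (h : q ≤ (l.take n).count a) : ∃ t ≤ n, (l.take t).count a = q := by
  induction n with
  | zero => exact ⟨0, le_rfl, by simp at h ⊢; omega⟩
  | succ n ih =>
    by_cases h1 : q ≤ (l.take n).count a
    · obtain ⟨t, ht, e⟩ := ih h1
      exact ⟨t, by omega, e⟩
    · refine ⟨n + 1, le_rfl, ?_⟩
      have := count_take_succ l a n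
      split_ifs at this <;> omega

/-! ### Trading a distant pair of moves `S 2`, `C 1` for a move `C 2` -/

/-- `s'` is `s` with a `C 1` played in advance, so it lacks two `F 1`. A move needs at most two of
them, so four in `s` suffice until the `C 1` is skipped and the positions agree. -/
theorem isGameFrom_erase_C_one {v w : List Move} {s s' : Multiset ℕ}
    (hs : s' + {1, 1} = s + {2}) (h : IsGameFrom s (v ++ .C 1 :: w))
    (hv : ∀ k ≤ v.length, 4 ≤ (after s (v.take k)).count 1) : IsGameFrom s' (v ++ w) := by
  induction v generalizing s s' with
  | nil =>
    have e : s' = play s (.C 1) := by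
      have e1 := play_add_removed h.1
      have e2 : (Move.C 1).removed = {1, 1} := rfl
      have e3 : (Move.C 1).added = {2} := rfl
      rw [e2, e3, ← hs] at e1
      exact (add_right_cancel e1).symm
    rw [e]
    exact h.2
  | cons m v ih =>
    have h4 : 4 ≤ s.count 1 := by simpa using hv 0 (by simp)
    have hm : Playable s' m := by
      refine ⟨h.1.1, Multiset.le_iff_count.2 fun x => ?_⟩
      have h1 := congrArg (Multiset.count x) hs
      have h2 := Multiset.le_iff_count.1 h.1.2 x
      have h3 := count_removed_le m x
      by_cases hx : x = 1
      · subst hx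
        simp at h1
        omega
      · simp [Multiset.insert_eq_cons, Multiset.count_singleton, hx] at h1
        omega
    refine ⟨hm, ih ?_ h.2 fun k hk => by simpa using hv (k + 1) (by simpa using hk)⟩
    have e1 := play_add_removed h.1
    have e2 := play_add_removed hm
    refine add_right_cancel (b := m.removed) ?_
    rw [add_right_comm, e2, add_right_comm _ {2}, e1, add_right_comm, hs, add_right_comm]

/-- `s'` is `s` with a `C 1` undone, so it lacks one `F 2`; three in `s` leave the two a move may
need. Playing `C 2` for `S 2` makes the positions agree. -/
theorem isGameFrom_replace_S_two {v w : List Move} {s s' : Multiset ℕ}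
    (hs : s' + {2} = s + {1, 1}) (h : IsGameFrom s (v ++ .S 2 :: w))
    (hv : ∀ k ≤ v.length, 3 ≤ (after s (v.take k)).count 2) :
    IsGameFrom s' (v ++ .C 2 :: w) := by
  induction v generalizing s s' with
  | nil =>
    have h3 : 3 ≤ s.count 2 := by simpa using hv 0 (by simp)
    have c1 := congrArg (Multiset.count 1) hs
    have c2 := congrArg (Multiset.count 2) hs
    simp at c1 c2
    have p : Playable s' (.C 2) := playable_C_two.2 (by omega)
    have e : play s' (.C 2) = play s (.S 2) := by
      ext x
      have f1 := count_play h.1 x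
      have f2 := count_play p x
      have f3 := congrArg (Multiset.count x) hs
      simp [Move.removed, Move.added, Multiset.insert_eq_cons, Multiset.count_cons,
        Multiset.count_singleton] at f1 f2 f3
      omega
    exact ⟨p, e ▸ h.2⟩
  | cons m v ih =>
    have h3 : 3 ≤ s.count 2 := by simpa using hv 0 (by simp)
    have hm : Playable s' m := by
      refine ⟨h.1.1, Multiset.le_iff_count.2 fun x => ?_⟩
      have h1 := congrArg (Multiset.count x) hs
      have h2 := Multiset.le_iff_count.1 h.1.2 x
      have h4 : m.removed.count 2 ≤ 2 := count_removed_le m 2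
      by_cases hx : x = 2
      · subst hx
        simp at h1
        omega
      · have h5 : ({2} : Multiset ℕ).count x = 0 := by simp [hx]
        rw [Multiset.count_add, Multiset.count_add, h5] at h1
        omega
    refine ⟨hm, ih ?_ h.2 fun k hk => by simpa using hv (k + 1) (by simpa using hk)⟩
    have e1 := play_add_removed h.1
    have e2 := play_add_removed hm
    refine add_right_cancel (b := m.removed) ?_
    rw [add_right_comm, e2, add_right_comm _ {1, 1}, e1, add_right_comm, hs, add_right_comm]

/-- `C 2` in place of `S 2` has the effect of the later `C 1` already included. -/
theorem isGameFrom_trade_of_lt {s : Multiset ℕ} {l : List Move} (h : IsGameFrom s l) {j i : ℕ}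
    (hji : j < i) (hj : l[j]? = some (.S 2)) (hi : l[i]? = some (.C 1))
    (hk : ∀ k, j < k → k ≤ i → 4 ≤ (after s (l.take k)).count 1) :
    IsGameFrom s ((l.set j (.C 2)).eraseIdx i) := by
  induction l generalizing s j i with
  | nil => simp at hj
  | cons m l ih =>
    obtain ⟨i, rfl⟩ : ∃ i', i = i' + 1 := ⟨i - 1, by omega⟩
    rcases j with _ | j
    · simp only [List.getElem?_cons_zero, Option.some.injEq] at hj
      subst hj
      simp only [List.getElem?_cons_succ] at hi
      obtain ⟨hlt, hi⟩ := List.getElem?_eq_some_iff.1 hi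
      have e : l = l.take i ++ .C 1 :: l.drop (i + 1) := by
        rw [← hi, List.cons_getElem_drop_succ, List.take_append_drop]
      have p : 4 ≤ (play s (.S 2)).count 1 := by simpa using hk 1 (by omega) (by omega)
      have c := count_play_S_two h.1
      have q : Playable s (.C 2) := playable_C_two.2 (by omega)
      simp only [List.set_cons_zero, List.eraseIdx_cons_succ]
      refine ⟨q, ?_⟩
      rw [List.eraseIdx_eq_take_drop_succ]
      refine isGameFrom_erase_C_one (s := play s (.S 2)) ?_ (e ▸ h.2) fun k hk' => ?_
      · ext x
        have f1 := count_play h.1 x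
        have f2 := count_play q x
        simp [Move.removed, Move.added, Multiset.insert_eq_cons, Multiset.count_cons,
          Multiset.count_singleton] at f1 f2 ⊢
        omega
      · rw [List.length_take] at hk'
        rw [List.take_take, min_eq_left (by omega)]
        simpa using hk (k + 1) (by omega) (by omega)
    · simp only [List.getElem?_cons_succ] at hj hi
      simp only [List.set_cons_succ, List.eraseIdx_cons_succ]
      exact ⟨h.1, ih h.2 (by omega) hj hi fun k h1 h2 => by
        simpa using hk (k + 1) (by omega) (by omega)⟩

/-- Here the `C 1` is omitted first, and `C 2` in place of the later `S 2` makes up for it. -/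
theorem isGameFrom_trade_of_gt {s : Multiset ℕ} {l : List Move} (h : IsGameFrom s l) {j i : ℕ}
    (hij : i < j) (hj : l[j]? = some (.S 2)) (hi : l[i]? = some (.C 1))
    (hk : ∀ k, i < k → k ≤ j → 3 ≤ (after s (l.take k)).count 2) :
    IsGameFrom s ((l.set j (.C 2)).eraseIdx i) := by
  induction l generalizing s j i with
  | nil => simp at hj
  | cons m l ih =>
    obtain ⟨j, rfl⟩ : ∃ j', j = j' + 1 := ⟨j - 1, by omega⟩
    rcases i with _ | i
    · simp only [List.getElem?_cons_zero, Option.some.injEq] at hi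
      subst hi
      simp only [List.getElem?_cons_succ] at hj
      obtain ⟨hlt, hj⟩ := List.getElem?_eq_some_iff.1 hj
      have e : l = l.take j ++ .S 2 :: l.drop (j + 1) := by
        rw [← hj, List.cons_getElem_drop_succ, List.take_append_drop]
      simp only [List.set_cons_succ, List.eraseIdx_cons_zero]
      rw [List.set_eq_take_append_cons_drop, if_pos hlt]
      refine isGameFrom_replace_S_two (s := play s (.C 1)) ?_ (e ▸ h.2) fun k hk' => ?_
      · exact (play_add_removed h.1).symm
      · rw [List.length_take] at hk'
        rw [List.take_take, min_eq_left (by omega)]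
        simpa using hk (k + 1) (by omega) (by omega)
    · simp only [List.getElem?_cons_succ] at hj hi
      simp only [List.set_cons_succ, List.eraseIdx_cons_succ]
      exact ⟨h.1, ih h.2 (by omega) hj hi fun k h1 h2 => by
        simpa using hk (k + 1) (by omega) (by omega)⟩

/-! ### Games with few trades are rare -/

/-- A long game with few trades has many pairs of moves `S 2`, `C 1` that can be replaced by one
move `C 2`. -/
theorem exists_many_trades {N J : ℕ} (hN : 1000 * (J + 2) ≤ N) {l : List Move}
    (h : IsGameFrom (Multiset.replicate N 1) l)
    (hJ : trades false (Multiset.replicate N 1) l ≤ J) :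
    ∃ A B : Finset ℕ, N / 100 ≤ A.card ∧ N / 100 ≤ B.card ∧ ∀ j ∈ A, ∀ i ∈ B,
      l[j]? = some (.S 2) ∧ l[i]? = some (.C 1) ∧ (l.take j).count (.C 2) ≤ J + 1 ∧
      IsGameFrom (Multiset.replicate N 1) ((l.set j (.C 2)).eraseIdx i) := by
  set s := Multiset.replicate N 1 with hs
  set q := N / 100 with hq
  have s1 : s.count 1 = N := by simp [hs]
  have s2 : s.count 2 = 0 := by simp [hs, Multiset.count_replicate]
  have s3 : upper s = 0 := by simp [hs, upper, upperWeight_one]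
  have I1 := count_one_take h
  have I2 := count_two_take h
  rw [s1] at I1
  simp only [s2, s3, add_zero] at I2
  have end1 : (after s l).count 1 ≤ 1 := by
    have := not_playable_after h (.C 1)
    rw [playable_C_one] at this
    omega
  have end2 : (after s l).count 2 ≤ 1 := by
    have := not_playable_after h (.S 2)
    rw [playable_S_two] at this
    omega
  have exτ : ∃ k, (after s (l.take k)).count 1 ≤ 4 := ⟨l.length, by rw [List.take_length]; omega⟩
  -- Before `τ` there are always enough `F 1` for the trades with `S 2` first.
  obtain ⟨τ, hτ, hτ'⟩ : ∃ τ, (after s (l.take τ)).count 1 ≤ 4 ∧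
      ∀ k < τ, 5 ≤ (after s (l.take k)).count 1 := by
    classical
    exact ⟨Nat.find exτ, Nat.find_spec exτ, fun k hk => by have := Nat.find_min exτ hk; omega⟩
  have yτ := count_C_two_le_trades s l τ τ (fun k hk => by have := hτ' k hk; omega)
    (fun k h1 h2 => by omega)
  have xτ := I1 τ
  -- Either `q` moves `S 2` are followed by `q` moves `C 1` before `τ`, or almost all `C 1` before
  -- `τ` occur while at most `q` moves `S 2` have been played.
  obtain ⟨t, htτ, hzt, hcase⟩ : ∃ t ≤ τ, (l.take t).count (.S 2) ≤ q ∧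
      (((l.take t).count (.S 2) = q ∧ (l.take t).count (.C 1) + q ≤ (l.take τ).count (.C 1)) ∨
      (l.take τ).count (.C 1) ≤ (l.take t).count (.C 1) + q) := by
    by_cases hz : q ≤ (l.take τ).count (.S 2)
    · obtain ⟨t, ht, e⟩ := exists_count_take_eq l _ hz
      refine ⟨t, ht, e.le, ?_⟩
      rcases le_total ((l.take t).count (.C 1) + q) ((l.take τ).count (.C 1)) with h1 | h1
      · exact Or.inl ⟨e, h1⟩
      · exact Or.inr h1
    · exact ⟨τ, le_rfl, by omega, Or.inr (by omega)⟩
  rcases hcase with ⟨hz, hx⟩ | hx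
  · refine ⟨indices l (.S 2) 0 t, indices l (.C 1) t τ, ?_, ?_, ?_⟩
    · have := card_indices l (.S 2) (Nat.zero_le t)
      simp at this
      omega
    · have := card_indices l (.C 1) htτ
      omega
    · intro j hj i hi
      simp only [indices, Finset.mem_filter, Finset.mem_Ico] at hj hi
      have := count_take_mono l (.C 2) (show j ≤ τ by omega)
      exact ⟨hj.2, hi.2, by omega, isGameFrom_trade_of_lt h (by omega) hj.2 hi.2 fun k _ h2 => by
        have := hτ' k (by omega)
        omega⟩
  -- About `0.48 * N` moves `C 1` with at most `N / 100` moves `S 2`: tokens `F 2` pile up. From the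
  -- `N / 5`-th `C 1` on, more than `N / 10` of them are present, as `0.2 - 0.07 > 0.1` with room
  -- for the few `C 2`.
  · have xt : 12 * N ≤ 25 * (l.take t).count (.C 1) + 200 := by omega
    obtain ⟨t₀, ht₀, hx₀⟩ := exists_count_take_eq l (.C 1) (q := N / 5) (n := t) (by omega)
    have yt := count_take_mono l (.C 2) htτ
    have low : ∀ k, t₀ ≤ k → k ≤ t → N / 10 < (after s (l.take k)).count 2 := fun k h1 h2 => by
      have := I2 k
      have := count_take_mono l (.C 1) h1
      have := count_take_mono l (.C 2) h2
      have := count_take_mono l (.S 2) h2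
      omega
    have exe : ∃ k, t ≤ k ∧ (after s (l.take k)).count 2 ≤ N / 10 := by
      refine ⟨max t l.length, le_max_left _ _, ?_⟩
      rw [List.take_of_length_le (le_max_right _ _)]
      omega
    -- The pile must go down by the end of the game. With few `C 2` this takes about `0.37 * N / 7`
    -- moves `S 2`, at most `N / 100` of them before `t`.
    obtain ⟨e, ⟨hte, he⟩, he'⟩ : ∃ e, (t ≤ e ∧ (after s (l.take e)).count 2 ≤ N / 10) ∧
        ∀ k, t ≤ k → k < e → N / 10 < (after s (l.take k)).count 2 := by
      classical
      exact ⟨Nat.find exe, Nat.find_spec exe, fun k h1 h2 => by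
        by_contra h3
        exact Nat.find_min exe h2 ⟨h1, by omega⟩⟩
    have ye := count_C_two_le_trades s l t e
      (fun k hk => by have := hτ' k (by omega); omega)
      (fun k h1 h2 => by have := he' k h1 h2; omega)
    have xe := count_take_mono l (.C 1) hte
    have Ie := I2 e
    refine ⟨indices l (.S 2) t e, indices l (.C 1) t₀ t, ?_, ?_, ?_⟩
    · have := card_indices l (.S 2) hte
      omega
    · have := card_indices l (.C 1) ht₀
      omega
    · intro j hj i hi
      simp only [indices, Finset.mem_filter, Finset.mem_Ico] at hj hi
      have := count_take_mono l (.C 2) (show j ≤ e by omega)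
      exact ⟨hj.2, hi.2, by omega, isGameFrom_trade_of_gt h (by omega) hj.2 hi.2 fun k h1 h2 => by
        rcases le_total k t with h3 | h3
        · have := low k (by omega) h3
          omega
        · have := he' k h3 (by omega)
          omega⟩

theorem potential_replicate_one (N : ℕ) : potential (Multiset.replicate N 1) = 3 * N := by
  have : tokenWeight 1 = 3 := tokenWeight_one
  simp [potential, this, mul_comm]

/-- The index `i` tells where to reinsert `C 1`; the number of earlier `C 2` tells which `C 2` to
turn back into `S 2`. -/
theorem trade_injective {l₁ l₂ : List Move} {j₁ j₂ i : ℕ}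
    (hj₁ : l₁[j₁]? = some (.S 2)) (hi₁ : l₁[i]? = some (.C 1))
    (hj₂ : l₂[j₂]? = some (.S 2)) (hi₂ : l₂[i]? = some (.C 1))
    (he : (l₁.set j₁ (.C 2)).eraseIdx i = (l₂.set j₂ (.C 2)).eraseIdx i)
    (hc : (l₁.take j₁).count (.C 2) = (l₂.take j₂).count (.C 2)) : l₁ = l₂ ∧ j₁ = j₂ := by
  have key : ∀ {l : List Move} {j : ℕ}, l[j]? = some (.S 2) → l[i]? = some (.C 1) →
      (l.set j (.C 2))[i]? = some (.C 1) ∧ (l.set j (.C 2))[j]? = some (.C 2) ∧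
      ((l.set j (.C 2)).take j).count (.C 2) = (l.take j).count (.C 2) ∧
      (l.set j (.C 2)).set j (.S 2) = l := by
    intro l j hj hi
    have hne : j ≠ i := by rintro rfl; simp [hj] at hi
    obtain ⟨hlt, hj'⟩ := List.getElem?_eq_some_iff.1 hj
    refine ⟨by rw [List.getElem?_set_ne hne, hi], List.getElem?_set_self hlt, ?_, ?_⟩
    · rw [List.take_set, List.set_eq_of_length_le (by simp)]
    · rw [List.set_set, ← hj', List.set_getElem_self]
  have insert_back : ∀ {L : List Move}, L[i]? = some (.C 1) →
      (L.eraseIdx i).insertIdx i (.C 1) = L := by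
    intro L hL
    obtain ⟨hlt, hL⟩ := List.getElem?_eq_some_iff.1 hL
    rw [← hL, List.insertIdx_eraseIdx_getElem hlt]
  obtain ⟨a₁, b₁, c₁, d₁⟩ := key hj₁ hi₁
  obtain ⟨a₂, b₂, c₂, d₂⟩ := key hj₂ hi₂
  have eL : l₁.set j₁ (.C 2) = l₂.set j₂ (.C 2) := by
    rw [← insert_back a₁, ← insert_back a₂, he]
  rw [eL] at b₁ c₁ d₁
  set L := l₂.set j₂ (.C 2)
  have ej : j₁ = j₂ := by
    have h1 := count_take_succ L (.C 2) j₁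
    have h2 := count_take_succ L (.C 2) j₂
    rw [if_pos b₁] at h1
    rw [if_pos b₂] at h2
    rcases lt_trichotomy j₁ j₂ with h | h | h
    · have := count_take_mono L (.C 2) (show j₁ + 1 ≤ j₂ from h)
      omega
    · exact h
    · have := count_take_mono L (.C 2) (show j₂ + 1 ≤ j₁ from h)
      omega
  refine ⟨?_, ej⟩
  rw [← d₁, ← d₂, ej]

/-- Games with few trades are rare. -/
theorem card_few_trades_mul_le {N J : ℕ} (hN : 1000 * (J + 2) ≤ N) :
    ((games (Multiset.replicate N 1)).filter
        fun l => trades false (Multiset.replicate N 1) l ≤ J).card * (N / 100 * (N / 100))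
      ≤ (games (Multiset.replicate N 1)).card * ((J + 2) * (3 * N)) := by
  classical
  set s := Multiset.replicate N 1 with hs
  set bad := (games s).filter fun l => trades false s l ≤ J with hbad
  have hb : ∀ l ∈ bad, IsGameFrom s l ∧ trades false s l ≤ J := fun l hl => by
    simpa [hbad] using hl
  have ex : ∀ l : List Move, ∃ A B : Finset ℕ, l ∈ bad →
      N / 100 ≤ A.card ∧ N / 100 ≤ B.card ∧ ∀ j ∈ A, ∀ i ∈ B,
      l[j]? = some (.S 2) ∧ l[i]? = some (.C 1) ∧ (l.take j).count (.C 2) ≤ J + 1 ∧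
      IsGameFrom s ((l.set j (.C 2)).eraseIdx i) := by
    intro l
    by_cases hl : l ∈ bad
    · obtain ⟨A, B, h⟩ := exists_many_trades hN (hb l hl).1 (hb l hl).2
      exact ⟨A, B, fun _ => h⟩
    · exact ⟨∅, ∅, fun h => absurd h hl⟩
  choose A B hAB using ex
  have lower : bad.card * (N / 100 * (N / 100)) ≤ (bad.sigma fun l => A l ×ˢ B l).card := by
    rw [Finset.card_sigma, ← smul_eq_mul]
    refine Finset.card_nsmul_le_sum _ _ _ fun l hl => ?_
    rw [Finset.card_product]
    exact Nat.mul_le_mul (hAB l hl).1 (hAB l hl).2.1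
  refine lower.trans ?_
  -- The `C 2` count before `j` is at most `J + 1`, and `i` is below the length, which is at most
  -- the initial potential `3 * N`.
  have upper : ((games s) ×ˢ (Finset.range (J + 2) ×ˢ Finset.range (3 * N))).card
      = (games s).card * ((J + 2) * (3 * N)) := by simp
  rw [← upper]
  refine Finset.card_le_card_of_injOn
    (fun x => ((x.1.set x.2.1 (.C 2)).eraseIdx x.2.2, ((x.1.take x.2.1).count (.C 2), x.2.2)))
    ?_ ?_
  · rintro ⟨l, j, i⟩ hx
    simp only [Finset.coe_sigma, Set.mem_sigma_iff, Finset.mem_coe, Finset.mem_product] at hx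
    obtain ⟨hl, hj, hi⟩ := hx
    obtain ⟨h1, h2, h3, h4⟩ := (hAB l hl).2.2 j hj i hi
    have len := length_le_potential (hb l hl).1
    rw [hs, potential_replicate_one] at len
    have := (List.getElem?_eq_some_iff.1 h2).1
    simp only [Finset.coe_product, Set.mem_prod, Finset.mem_coe, mem_games, Finset.mem_range]
    exact ⟨h4, by omega, by omega⟩
  · rintro ⟨l₁, j₁, i₁⟩ hx₁ ⟨l₂, j₂, i₂⟩ hx₂ e
    simp only [Finset.coe_sigma, Set.mem_sigma_iff, Finset.mem_coe, Finset.mem_product] at hx₁ hx₂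
    obtain ⟨p1, p2, _, _⟩ := (hAB l₁ hx₁.1).2.2 j₁ hx₁.2.1 i₁ hx₁.2.2
    obtain ⟨q1, q2, _, _⟩ := (hAB l₂ hx₂.1).2.2 j₂ hx₂.2.1 i₂ hx₂.2.2
    simp only [Prod.mk.injEq] at e
    obtain ⟨e1, e2, rfl⟩ := e
    obtain ⟨rfl, rfl⟩ := trade_injective p1 p2 q1 q2 e1 e2
    rfl

/-! ### Limits of the character sums -/

theorem card_games_pos (s : Multiset ℕ) : 0 < (games s).card := by
  obtain ⟨l, hl⟩ := exists_isGameFrom s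
  exact Finset.card_pos.2 ⟨l, mem_games.2 hl⟩

theorem tradeSum_le {κ : ℝ} (hκ0 : 0 ≤ κ) (hκ1 : κ ≤ 1) (s : Multiset ℕ) (J : ℕ) :
    tradeSum κ false s ≤ ((games s).filter fun l => trades false s l ≤ J).card
      + (games s).card * κ ^ J := by
  classical
  rw [tradeSum, Finset.card_filter, Nat.cast_sum, ← nsmul_eq_mul, ← Finset.sum_const,
    ← Finset.sum_add_distrib]
  refine Finset.sum_le_sum fun l _ => ?_
  by_cases h : trades false s l ≤ J
  · simpa [h] using (pow_le_one₀ hκ0 hκ1).trans (le_add_of_nonneg_right (pow_nonneg hκ0 J))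
  · simpa [h] using pow_le_pow_of_le_one hκ0 hκ1 (by omega : J ≤ trades false s l)

theorem norm_one_add_lt_two {ω : ℂ} (hω : ‖ω‖ = 1) (h1 : ω ≠ 1) : ‖1 + ω‖ < 2 := by
  have h : ¬ SameRay ℝ 1 ω := by
    rw [sameRay_iff_of_norm_eq (by rw [hω, norm_one])]
    exact fun h => h1 h.symm
  have := norm_add_lt_of_not_sameRay h
  rw [norm_one, hω] at this
  linarith

theorem tendsto_charSum {ω : ℂ} (hω : ‖ω‖ = 1) (h1 : ω ≠ 1) :
    Tendsto (fun N : ℕ => ((games (Multiset.replicate N 1)).card : ℂ)⁻¹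
      * charSum ω (Multiset.replicate N 1)) atTop (𝓝 0) := by
  set κ := ‖1 + ω‖ / 2 with hκ
  have hκ0 : 0 ≤ κ := by positivity
  have hκ1 : κ < 1 := by have := norm_one_add_lt_two hω h1; rw [hκ]; linarith
  rw [Metric.tendsto_atTop]
  intro ε hε
  obtain ⟨J, hJ⟩ := exists_pow_lt_of_lt_one (half_pos hε) hκ1
  -- As `N / 100 ≥ N / 200` after rounding down, the proportion of games with few trades is at most
  -- `3 * 200 ^ 2 * (J + 2) / N`.
  obtain ⟨M, hM⟩ := exists_nat_gt (120000 * (J + 2) / (ε / 2))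
  refine ⟨max (1000 * (J + 2)) M, fun N hN => ?_⟩
  have hN1 : 1000 * (J + 2) ≤ N := (le_max_left _ _).trans hN
  have hN2 : (M : ℝ) ≤ N := by exact_mod_cast (le_max_right _ _).trans hN
  have hNpos : (0 : ℝ) < N := by
    have : 0 < N := by omega
    exact_mod_cast this
  set s := Multiset.replicate N 1 with hs
  have hn : (0 : ℝ) < (games s).card := by exact_mod_cast card_games_pos s
  have b1 := (norm_charSum_le_tradeSum hω s).trans (tradeSum_le hκ0 hκ1.le s J)
  have b2 : (((games s).filter fun l => trades false s l ≤ J).card : ℝ)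
      ≤ (games s).card * (ε / 2) := by
    have c1 : (((games s).filter fun l => trades false s l ≤ J).card : ℝ)
        * (((N / 100 : ℕ) : ℝ) * ((N / 100 : ℕ) : ℝ))
        ≤ (games s).card * ((J + 2) * (3 * N)) := by exact_mod_cast card_few_trades_mul_le hN1
    have c2 : (N : ℝ) / 200 ≤ ((N / 100 : ℕ) : ℝ) := by
      rw [div_le_iff₀ (by norm_num)]
      have : N ≤ N / 100 * 200 := by omega
      exact_mod_cast this
    have c3 : (N : ℝ) / 200 * (N / 200) ≤ ((N / 100 : ℕ) : ℝ) * ((N / 100 : ℕ) : ℝ) :=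
      mul_le_mul c2 c2 (by positivity) (by positivity)
    have c4 := (mul_le_mul_of_nonneg_left c3 (Nat.cast_nonneg _)).trans c1
    have c5 : 120000 * ((J : ℝ) + 2) ≤ N * (ε / 2) :=
      ((div_lt_iff₀ (half_pos hε)).1 (hM.trans_le hN2)).le
    refine le_of_mul_le_mul_right (c4.trans ?_)
      (show (0 : ℝ) < (N : ℝ) / 200 * (N / 200) by positivity)
    have c6 := mul_le_mul_of_nonneg_left c5 (show (0 : ℝ) ≤ (games s).card * (N / 40000) by
        positivity)
    linarith
  rw [dist_zero_right, norm_mul, norm_inv, Complex.norm_natCast, inv_mul_lt_iff₀ hn]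
  have b3 := mul_lt_mul_of_pos_left hJ hn
  linarith

theorem tendsto_log_two : Tendsto (Nat.log 2) atTop atTop :=
  tendsto_atTop.2 fun b => (eventually_ge_atTop (2 ^ b)).mono fun _ h =>
    Nat.le_log_of_pow_le (by norm_num) h

theorem tendsto_log_pow_div : Tendsto (fun N : ℕ => ((4 * Nat.log 2 N + 4 : ℕ) : ℝ) ^ 3 / N)
    atTop (𝓝 0) := by
  -- With `L = Nat.log 2 N`, `N ≥ 2 ^ L`; the constant is `128 = 4 ^ 3 * 2`.
  have h1 : Tendsto (fun N : ℕ => 128 * (((Nat.log 2 N + 1 : ℕ) : ℝ) ^ 3 / 2 ^ (Nat.log 2 N + 1)))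
      atTop (𝓝 0) := by
    have := (tendsto_pow_const_div_const_pow_of_one_lt 3 (one_lt_two (α := ℝ))).comp
      ((tendsto_add_atTop_nat 1).comp tendsto_log_two)
    simpa using this.const_mul 128
  refine squeeze_zero' (Eventually.of_forall fun N => by positivity) ?_ h1
  filter_upwards [eventually_ge_atTop 1] with N hN
  have h2 : (2 : ℝ) ^ Nat.log 2 N ≤ N := by exact_mod_cast Nat.pow_log_le_self 2 (by omega)
  have h3 : (0 : ℝ) < 2 ^ Nat.log 2 N := by positivity
  have e : 128 * (((Nat.log 2 N + 1 : ℕ) : ℝ) ^ 3 / 2 ^ (Nat.log 2 N + 1))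
      = ((4 * Nat.log 2 N + 4 : ℕ) : ℝ) ^ 3 / 2 ^ Nat.log 2 N := by
    push_cast
    rw [pow_succ (2 : ℝ)]
    field_simp
    ring
  rw [e]
  exact div_le_div_of_nonneg_left (by positivity) h3 h2

theorem tendsto_randomCharSum {ω : ℂ} (hω : ‖ω‖ = 1) (h1 : ω ≠ 1) :
    Tendsto (fun N : ℕ => randomCharSum ω (Multiset.replicate N 1)) atTop (𝓝 0) := by
  set δ : ℝ := (2 - ‖1 + ω‖) / 2 with hδ
  have hδ0 : 0 < δ := by have := norm_one_add_lt_two hω h1; rw [hδ]; linarith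
  have hδ1 : δ ≤ 1 := by have := norm_nonneg (1 + ω); rw [hδ]; linarith
  -- The bound is `exp (-x)` with `x = δ * N / (12 * K ^ 3)`; the 12 absorbs rounding in `N / 6`.
  have inf : Tendsto (fun N : ℕ => δ / 12 * (((4 * Nat.log 2 N + 4 : ℕ) : ℝ) ^ 3 / N)⁻¹)
      atTop atTop := by
    refine Tendsto.const_mul_atTop (by positivity) (tendsto_inv_nhdsGT_zero.comp ?_)
    refine tendsto_nhdsWithin_iff.2 ⟨tendsto_log_pow_div, ?_⟩
    filter_upwards [eventually_ge_atTop 1] with N hN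
    have : (0 : ℝ) < N := by exact_mod_cast hN
    exact Set.mem_Ioi.2 (by positivity)
  refine squeeze_zero_norm' ?_ (Real.tendsto_exp_neg_atTop_nhds_zero.comp inf)
  filter_upwards [eventually_ge_atTop 12] with N hN
  set K := 4 * Nat.log 2 N + 4 with hK
  have b := norm_randomCharSum_le hω (K := K) (N := N)
      (fun s hs => by simpa only [hs] using numPlayable_le s) (N / 6)
    (Multiset.replicate N 1) (by simp) (by simp; omega)
  refine b.trans ?_
  have K3 : (1 : ℝ) ≤ (K : ℝ) ^ 3 := one_le_pow₀ (by exact_mod_cast (by omega : 1 ≤ K))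
  have hx1 : δ / (K : ℝ) ^ 3 ≤ 1 := (div_le_one (by linarith)).2 (by linarith)
  refine (pow_le_pow_left₀ (sub_nonneg.2 hx1) (Real.one_sub_le_exp_neg _) _).trans ?_
  rw [← Real.exp_nat_mul, Function.comp_apply, Real.exp_le_exp, inv_div]
  have c : (N : ℝ) / 12 ≤ ((N / 6 : ℕ) : ℝ) := by
    rw [div_le_iff₀ (by norm_num)]
    have : N ≤ N / 6 * 12 := by omega
    exact_mod_cast this
  have d := mul_le_mul_of_nonneg_right c (show 0 ≤ δ / (K : ℝ) ^ 3 by positivity)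
  have e : δ / 12 * ((N : ℝ) / (K : ℝ) ^ 3) = N / 12 * (δ / (K : ℝ) ^ 3) := by ring
  rw [e]
  linarith

/-! ### From character sums to residue classes -/

/-- Weights on the games for which the character sums tend to zero make the length
equidistributed. -/
theorem tendsto_sum_length_modEq {Z : ℕ} (hZ : 1 ≤ Z) {z : ℕ} (hz : z < Z)
    (A : ℕ → Finset (List Move)) (w : ℕ → List Move → ℝ) (hw : ∀ N, ∑ l ∈ A N, w N l = 1)
    (h : ∀ ω : ℂ, ‖ω‖ = 1 → ω ≠ 1 →
      Tendsto (fun N => ∑ l ∈ A N, (w N l : ℂ) * ω ^ l.length) atTop (𝓝 0)) :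
    Tendsto (fun N => ∑ l ∈ A N, if l.length ≡ z [MOD Z] then w N l else 0) atTop
      (𝓝 (1 / (Z : ℝ))) := by
  set ζ := Complex.exp (2 * Real.pi * Complex.I / Z) with hζ
  have prim : IsPrimitiveRoot ζ Z := Complex.isPrimitiveRoot_exp Z (by omega)
  have hZ0 : (Z : ℂ) ≠ 0 := by exact_mod_cast (by omega : Z ≠ 0)
  -- Orthogonality of the characters mod `Z`, with `Z - z` in place of `-z` to stay in `ℕ`.
  have ind : ∀ n : ℕ, (if n ≡ z [MOD Z] then (1 : ℂ) else 0)
      = (Z : ℂ)⁻¹ * ∑ k ∈ Finset.range Z, (ζ ^ k) ^ (n + (Z - z)) := by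
    intro n
    have e : ∀ k, (ζ ^ k) ^ (n + (Z - z)) = (ζ ^ (n + (Z - z))) ^ k := fun k => by
      rw [← pow_mul, ← pow_mul, mul_comm]
    have d : n ≡ z [MOD Z] ↔ ζ ^ (n + (Z - z)) = 1 := by
      rw [prim.pow_eq_one_iff_dvd, ← Nat.modEq_zero_iff_dvd]
      constructor
      · intro hn
        have := hn.add_right (Z - z)
        rw [Nat.add_sub_cancel' hz.le] at this
        exact this.trans (Nat.modEq_zero_iff_dvd.2 dvd_rfl)
      · intro hn
        refine Nat.ModEq.add_right_cancel' (Z - z) ?_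
        rw [Nat.add_sub_cancel' hz.le]
        exact hn.trans (Nat.modEq_zero_iff_dvd.2 dvd_rfl).symm
    simp_rw [e]
    by_cases h1 : ζ ^ (n + (Z - z)) = 1
    · rw [if_pos (d.2 h1), h1]
      simp [hZ0]
    · rw [if_neg (fun h => h1 (d.1 h)), geom_sum_eq h1, ← pow_mul, mul_comm _ Z, pow_mul,
        prim.pow_eq_one]
      simp
  have lim : Tendsto (fun N => (Z : ℂ)⁻¹ * ∑ k ∈ Finset.range Z,
      (ζ ^ k) ^ (Z - z) * ∑ l ∈ A N, (w N l : ℂ) * (ζ ^ k) ^ l.length) atTop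
      (𝓝 ((Z : ℂ)⁻¹ * ∑ k ∈ Finset.range Z, if k = 0 then 1 else 0)) := by
    refine Tendsto.const_mul _ (tendsto_finsetSum _ fun k hk => ?_)
    have hk := Finset.mem_range.1 hk
    by_cases h0 : k = 0
    · subst h0
      have : ∀ N, ∑ l ∈ A N, (w N l : ℂ) = 1 := fun N => by exact_mod_cast hw N
      simp [this]
    · have n1 : ‖ζ ^ k‖ = 1 := by
        rw [norm_pow, prim.norm'_eq_one (by omega), one_pow]
      have n2 : ζ ^ k ≠ 1 := prim.pow_ne_one_of_pos_of_lt h0 hk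
      simpa [h0] using (h _ n1 n2).const_mul ((ζ ^ k) ^ (Z - z))
  have lim' : Tendsto (fun N => ((∑ l ∈ A N, if l.length ≡ z [MOD Z] then w N l else 0 : ℝ) : ℂ))
      atTop (𝓝 ((1 / (Z : ℝ) : ℝ) : ℂ)) := by
    have e1 : ((1 / (Z : ℝ) : ℝ) : ℂ)
        = (Z : ℂ)⁻¹ * ∑ k ∈ Finset.range Z, if k = 0 then 1 else 0 := by
      rw [Finset.sum_ite_eq' (Finset.range Z) 0, if_pos (Finset.mem_range.2 (by omega))]
      simp
    rw [e1]
    refine lim.congr fun N => ?_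
    simp_rw [Finset.mul_sum]
    rw [Finset.sum_comm, Complex.ofReal_sum]
    refine Finset.sum_congr rfl fun l _ => ?_
    have e2 : (((if l.length ≡ z [MOD Z] then w N l else 0 : ℝ)) : ℂ)
        = w N l * (if l.length ≡ z [MOD Z] then (1 : ℂ) else 0) := by split_ifs <;> simp
    rw [e2, ind, Finset.mul_sum, Finset.mul_sum]
    refine Finset.sum_congr rfl fun k _ => ?_
    rw [pow_add]
    ring
  have := (Complex.continuous_re.tendsto _).comp lim'
  simpa only [Function.comp_def, Complex.ofReal_re] using this

/-! ### Translation to measures -/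

theorem sum_game {M : Type*} [AddCommMonoid M] (N : ℕ) (φ : List Move → M) :
    ∑ G : Game N, φ G.1 = ∑ l ∈ games (Multiset.replicate N 1), φ l :=
  (Finset.sum_subtype (p := fun l => IsGameFrom (Multiset.replicate N (F 1)) l)
    (games (Multiset.replicate N 1)) (fun _ => mem_games) φ).symm

theorem real_toMeasure {N : ℕ} (p : PMF (Game N)) (w : List Move → ℝ)
    (hp : ∀ G : Game N, (p G).toReal = w G.1) (Q : ℕ → Prop) [DecidablePred Q] :
    p.toMeasure.real {G : Game N | Q G.length}
      = ∑ l ∈ games (Multiset.replicate N 1), if Q l.length then w l else 0 := by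
  rw [← sum_game, MeasureTheory.measureReal_def, PMF.toMeasure_apply_fintype,
    ENNReal.toReal_sum fun G _ => ?_]
  · refine Finset.sum_congr rfl fun G _ => ?_
    by_cases hG : Q G.length
    · have hG' : Q G.1.length := hG
      simp [Set.indicator, hG, hG', hp]
    · have hG' : ¬ Q G.1.length := hG
      simp [Set.indicator, hG, hG']
  · by_cases hG : Q G.length <;> simp [Set.indicator, hG, p.apply_ne_top]

theorem sum_stepWeight_toReal (s : Multiset ℕ) : ∑ l ∈ games s, (stepWeight s l).toReal = 1 := by
  classical
  have h := tsum_stepWeight s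
  rw [tsum_eq_sum (s := games s) fun l hl => by simp_all] at h
  rw [Finset.sum_congr rfl (g := fun l => stepWeight s l) fun l hl => by simp_all] at h
  have hne : ∀ l ∈ games s, stepWeight s l ≠ ∞ := fun l hl =>
    ne_top_of_le_ne_top ENNReal.one_ne_top (h ▸ Finset.single_le_sum (fun _ _ => zero_le) hl)
  rw [← ENNReal.toReal_sum hne, h, ENNReal.toReal_one]

end Zeckendorf

theorem theorem1p8 (Z : ℕ) (hZ : 1 ≤ Z) (z : ℕ) (hz : z < Z) :
    Tendsto (fun N : ℕ => (Zeckendorf.uniformMeasure N).real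
        {G : Zeckendorf.Game N | G.length ≡ z [MOD Z]}) atTop (𝓝 (1 / (Z : ℝ))) ∧
    Tendsto (fun N : ℕ => (Zeckendorf.randomMoveMeasure N).real
        {G : Zeckendorf.Game N | G.length ≡ z [MOD Z]}) atTop (𝓝 (1 / (Z : ℝ))) := by
  open Zeckendorf in
  constructor
  · have lim := tendsto_sum_length_modEq hZ hz (fun N => games (Multiset.replicate N 1))
      (fun N _ => ((games (Multiset.replicate N 1)).card : ℝ)⁻¹)
      (fun N => by
        rw [Finset.sum_const, nsmul_eq_mul]
        exact mul_inv_cancel₀ (by exact_mod_cast (card_games_pos _).ne'))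
      (fun ω hω h1 => by
        refine (tendsto_charSum hω h1).congr fun N => ?_
        rw [charSum, Finset.mul_sum]
        simp)
    refine lim.congr fun N => ?_
    refine (real_toMeasure _ _ (fun G => ?_) (fun n => n ≡ z [MOD Z])).symm
    have hc : Fintype.card (Game N) = (games (Multiset.replicate N 1)).card := by
      rw [← Finset.card_univ, Finset.card_eq_sum_ones, Finset.card_eq_sum_ones]
      exact sum_game N fun _ => 1
    rw [PMF.uniformOfFintype_apply, hc]
    simp
  · have lim := tendsto_sum_length_modEq hZ hz (fun N => games (Multiset.replicate N 1))
      (fun N l => (stepWeight (Multiset.replicate N 1) l).toReal)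
      (fun N => sum_stepWeight_toReal _)
      (fun ω hω h1 => tendsto_randomCharSum hω h1)
    refine lim.congr fun N => ?_
    exact (real_toMeasure _ _ (fun G => rfl) (fun n => n ≡ z [MOD Z])).symm
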